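/- Write points of $\mathbb{R}^{2n}$ as $z=(\boldsymbol{x},\boldsymbol{u})$ with $\boldsymbol{x},\boldsymbol{u}\in\mathbb{R}^n$. Let $f\in\mathcal{S}(\mathbb{R}^{2n})$. **Transforms.** Given a map $c:\{1,\dots,n\}\to\{1,\dots,m\}$, put for $\boldsymbol{\alpha}\in(\mathbb{R}\setminus\{0\})^m$, $\bar{\boldsymbol{x}}\in\mathbb{R}^n$ $$P_cf(\boldsymbol{\alpha},\bar{\boldsymbol{x}})=\Big(\prod_{k=1}^n|\alpha_{c(k)}|\Big)^{-1}\int_{\mathbb{R}^n}f\Big(\Big(\tfrac{1}{\alpha_{c(k)}}\bar x_k+\big(1-\tfrac1{\alpha_{c(k)}}\big)u_k\Big)_{k=1}^n,\boldsymbol{u}\Big)\,d\boldsymbol{u},$$ $$P_c^*g(\boldsymbol{x},\boldsymbol{u})=\int_{\mathbb{R}^m}g\big(\boldsymbol{\alpha},(\alpha_{c(k)}x_k+(1-\alpha_{c(k)})u_k)_{k=1}^n\big)\,d\boldsymbol{\alpha}.$$ $\bar P$ is $P_c$ with $m=n$, $c(k)=k$; $\widetilde P$ is $P_c$ with $m=\lceil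 n/2\rceil$, $c(k)=\lceil k/2\rceil$ (so $x_{2i-1},x_{2i}$ share the parameter $\alpha_i$ and, for odd $n$, $x_n$ has its own parameter $\alpha_{(n+1)/2}$). **Kernels.** For $1\le i\le\lfloor n/2\rfloor$ let $\phi_i=\arg(x_{2i-1},u_{2i-1})$, $\varphi_i=\arg(x_{2i},u_{2i})\in[0,2\pi)$. Let $\prod_i\delta(\sin(\phi_i-\varphi_i))$ be the unique Radon measure $\nu$ on $\mathbb{R}^{2n}$ such that, for every continuous compactly supported $\psi$ and every nonnegative $\rho\in C_c^\infty(\mathbb{R})$ with $\int\rho=1$, $$\int\psi\,d\nu=\lim_{\varepsilon\to0^+}\int_{\mathbb{R}^{2n}}\prod_i\varepsilon^{-1}\rho\big(\varepsilon^{-1}\sin(\phi_i-\varphi_i)\big)\,\psi\,d\boldsymbol{x}\,d\boldsymbol{u}$$ (an empty product being $1$). Consider the positive kernels $$\bar K=\prod_{k=1}^n|x_k-u_k|^{-1},\qquad \widetilde K=\frac{\prod_{i=1}^{n/2}\delta(\sin(\phi_i-\varphi_i))}{\prod_{k=1}^{n}\|(x_k,u_k)\|}\ (n\text{ even}),\qquad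 \widetilde K=\frac{\prod_{i=1}^{(n-1)/2}\delta(\sin(\phi_i-\varphi_i))}{|x_n-u_n|\prod_{k=1}^{n-1}\|(x_k,u_k)\|}\ (n\text{ odd}),$$ regarded as measures ($\bar K$ as a density with respect to Lebesgue measure), and put $(K*f)(z)=\int f(z-w)\,dK(w)$. **Proposition.** The integrals defining $\bar Pf(\boldsymbol{\alpha},\bar{\boldsymbol{x}})$ and $\widetilde Pf(\boldsymbol{\alpha},\bar{\boldsymbol{x}})$ converge absolutely whenever all entries of $\boldsymbol{\alpha}$ are nonzero, the limit measure $\prod_i\delta(\sin(\phi_i-\varphi_i))$ exists, and the following hold at every $z=(\boldsymbol{x},\boldsymbol{u})\in\mathbb{R}^{2n}$. (i) $\bar P^*\bar Pf=\bar K*f$, in the following sense: $\bar P^*\bar P|f|(z)=(\bar K*|f|)(z)$ in $[0,\infty]$; if $(\bar K*|f|)(z)<\infty$, then the integral over $\boldsymbol{\alpha}$ defining $\bar P^*\bar Pf(z)$ converges absolutely and $\bar P^*\bar Pf(z)=(\bar K*f)(z)$; and, without any restriction on $f$, for every $A\in\mathbb{R}$ both sides of $$\int_{\{|\alpha_k|\le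 A\ \forall k\}}\bar Pf\big(\boldsymbol{\alpha},(\alpha_kx_k+(1-\alpha_k)u_k)_k\big)\,d\boldsymbol{\alpha}=\int_{\{(\boldsymbol{y},\boldsymbol{v}):\,|v_k|\le A|y_k-v_k|\ \forall k\}}f(\boldsymbol{x}-\boldsymbol{y},\boldsymbol{u}-\boldsymbol{v})\,d\bar K(\boldsymbol{y},\boldsymbol{v})$$ converge absolutely and they are equal. (ii) If $n$ is even, then $\widetilde P^*\widetilde P|f|(z)=(\widetilde K*|f|)(z)$, the integrals defining $\widetilde P^*\widetilde Pf(z)$ and $(\widetilde K*f)(z)$ converge absolutely, and $\widetilde P^*\widetilde Pf(z)=(\widetilde K*f)(z)$. If $n$ is odd, then $\widetilde P^*\widetilde Pf=\widetilde K*f$ in the same sense as in (i), where in the truncated identity only the last parameter is truncated, i.e. the integral over $\boldsymbol{\alpha}$ is over $\{|\alpha_{(n+1)/2}|\le A\}$ and the integral against $\widetilde K$ is over $\{|v_n|\le A|y_n-v_n|\}$. -/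

import Mathlib

open MeasureTheory Filter Topology
open scoped ENNReal ContDiff BigOperators

noncomputable section

namespace Photography

/-- The phase space `ℝⁿ × ℝⁿ`, with points `z = (x, u)`. -/
abbrev Phase (n : ℕ) : Type := (Fin n → ℝ) × (Fin n → ℝ)

/-! ### Photography transforms and their duals

A coupling `c : Fin n → ι` says which parameter `α_{c k}` multiplies the `k`-th pair of
variables `(x_k, u_k)`. -/

section Transforms

variable {n : ℕ} {ι : Type} [Fintype ι]

/-- The point `((x̄_k / α_{c k} + (1 - 1 / α_{c k}) u_k)_k, u)` at which `f` is evaluated. -/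
def ray (c : Fin n → ι) (α : ι → ℝ) (xbar u : Fin n → ℝ) : Phase n :=
  (fun k => 1 / α (c k) * xbar k + (1 - 1 / α (c k)) * u k, u)

/-- The point `(α_{c k} x_k + (1 - α_{c k}) u_k)_k`. -/
def focal (c : Fin n → ι) (α : ι → ℝ) (z : Phase n) : Fin n → ℝ :=
  fun k => α (c k) * z.1 k + (1 - α (c k)) * z.2 k

/-- The photography transform with coupling `c`, for parameters `α` with nonzero entries:
`(∏ₖ |α_{c k}|)⁻¹ ∫ f((x̄_k / α_{c k} + (1 - 1 / α_{c k}) u_k)_k, u) du`. -/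
def transform (c : Fin n → ι) (f : Phase n → ℂ) (α : ι → ℝ) (xbar : Fin n → ℝ) : ℂ :=
  ((∏ k, |α (c k)|)⁻¹ : ℝ) • ∫ u, f (ray c α xbar u)

/-- The dual operator `(x, u) ↦ ∫ g(α, (α_{c k} x_k + (1 - α_{c k}) u_k)_k) dα`. -/
def dual (c : Fin n → ι) (g : (ι → ℝ) → (Fin n → ℝ) → ℂ) (z : Phase n) : ℂ :=
  ∫ α, g α (focal c α z)

/-- The same transform for `[0, ∞]`-valued functions. -/
def etransform (c : Fin n → ι) (f : Phase n → ℝ≥0∞) (α : ι → ℝ) (xbar : Fin n → ℝ) : ℝ≥0∞ :=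
  (∏ k, ENNReal.ofReal |α (c k)|)⁻¹ * ∫⁻ u, f (ray c α xbar u)

/-- The same dual operator for `[0, ∞]`-valued functions. -/
def edual (c : Fin n → ι) (g : (ι → ℝ) → (Fin n → ℝ) → ℝ≥0∞) (z : Phase n) : ℝ≥0∞ :=
  ∫⁻ α, g α (focal c α z)

end Transforms

/-- The coupling of `P̄`: every pair `(x_k, u_k)` has its own parameter. -/
def barCoupling (n : ℕ) : Fin n → Fin n := id

/-- The coupling of `P̃`: the (zero-based) indices `2i` and `2i + 1` share the parameter `α_i`;
for odd `n` the last index has a parameter of its own. There are `n / 2` parameters for even `n`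
and `(n + 1) / 2` for odd `n`. -/
def tildeCoupling (n : ℕ) : Fin n → Fin ((n + 1) / 2) := fun k => ⟨k / 2, by omega⟩

/-! ### Kernels -/

/-- Convolution of a (positive) kernel measure with a function. -/
def conv {n : ℕ} (K : Measure (Phase n)) (f : Phase n → ℂ) (z : Phase n) : ℂ :=
  ∫ w, f (z - w) ∂K

/-- Convolution of a (positive) kernel measure with a `[0, ∞]`-valued function. -/
def econv {n : ℕ} (K : Measure (Phase n)) (f : Phase n → ℝ≥0∞) (z : Phase n) : ℝ≥0∞ :=
  ∫⁻ w, f (z - w) ∂K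

section Delta

variable {X : Type*} [TopologicalSpace X] [MeasureSpace X] {κ : Type*} [Fintype κ]

/-- A standard mollifier profile on the line. -/
structure IsMollifier (ρ : ℝ → ℝ) : Prop where
  smooth : ContDiff ℝ ∞ ρ
  compact : HasCompactSupport ρ
  nonneg : ∀ t, 0 ≤ ρ t
  integral_eq_one : ∫ t, ρ t = 1

/-- `ν` is the generalized function `δ(h) = ∏ᵢ δ(hᵢ)`: it is a Radon measure and the limit, tested
against continuous compactly supported functions, of `∏ᵢ ρ_ε(hᵢ)` with `ρ_ε(t) = ε⁻¹ ρ(t / ε)`,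
for every mollifier `ρ`. -/
structure IsDelta (h : X → κ → ℝ) (ν : Measure X) : Prop where
  finite : IsFiniteMeasureOnCompacts ν
  tendsto : ∀ ρ : ℝ → ℝ, IsMollifier ρ → ∀ ψ : X → ℝ, Continuous ψ → HasCompactSupport ψ →
    Tendsto (fun ε : ℝ => ∫ w, (∏ i, ε⁻¹ * ρ (h w i / ε)) * ψ w) (𝓝[>] 0) (𝓝 (∫ w, ψ w ∂ν))

open Classical in
/-- The measure `δ(h) = ∏ᵢ δ(hᵢ)` (zero if the limit does not exist). -/
def delta (h : X → κ → ℝ) : Measure X :=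
  if H : ∃ ν : Measure X, IsDelta h ν then H.choose else 0

end Delta

/-- There is at most one measure `δ(h)` on phase space. -/
theorem IsDelta.unique {n : ℕ} {κ : Type*} [Fintype κ] {h : Phase n → κ → ℝ}
    {ν ν' : Measure (Phase n)} (hν : IsDelta h ν) (hν' : IsDelta h ν') : ν = ν' := by
  have := hν.finite
  have := hν'.finite
  obtain ⟨b⟩ : Nonempty (ContDiffBump (0 : ℝ)) := inferInstance
  have hb : IsMollifier (b.normed volume) :=
    ⟨b.contDiff_normed, b.hasCompactSupport_normed, b.nonneg_normed, b.integral_normed⟩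
  refine Measure.ext_of_integral_eq_on_compactlySupported fun ψ => ?_
  exact tendsto_nhds_unique (hν.tendsto _ hb ψ ψ.continuous ψ.hasCompactSupport)
    (hν'.tendsto _ hb ψ ψ.continuous ψ.hasCompactSupport)

/-- The argument of `(a, b)` in `[0, 2π)`. -/
def angle (a b : ℝ) : ℝ := toIcoMod Real.two_pi_pos 0 (Complex.arg ⟨a, b⟩)

/-- The Euclidean norm of `(a, b)`. -/
def norm2 (a b : ℝ) : ℝ := Real.sqrt (a ^ 2 + b ^ 2)

/-- The first index `2i` (zero-based) of the `i`-th pair. -/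
def fstIdx {n : ℕ} (i : Fin (n / 2)) : Fin n := ⟨2 * i, by omega⟩

/-- The second index `2i + 1` (zero-based) of the `i`-th pair. -/
def sndIdx {n : ℕ} (i : Fin (n / 2)) : Fin n := ⟨2 * i + 1, by omega⟩

/-- The last index, for odd `n`. -/
def lastIdx {n : ℕ} (hn : Odd n) : Fin n := ⟨n - 1, by have := hn.pos; omega⟩

/-- `(x, u) ↦ (sin (φ_i - ϕ_i))_i`, where `φ_i` and `ϕ_i` are the arguments of the first and of the
second point `(x_k, u_k)` of the `i`-th pair. -/
def sinDiff (n : ℕ) (w : Phase n) (i : Fin (n / 2)) : ℝ :=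
  Real.sin (angle (w.1 (fstIdx i)) (w.2 (fstIdx i)) - angle (w.1 (sndIdx i)) (w.2 (sndIdx i)))

/-- The kernel `∏ₖ |x_k - u_k|⁻¹`. -/
def barKernel (n : ℕ) : Measure (Phase n) :=
  volume.withDensity fun w => ∏ k, (ENNReal.ofReal |w.1 k - w.2 k|)⁻¹

/-- `∏ᵢ (‖(x_{2i}, u_{2i})‖ ‖(x_{2i+1}, u_{2i+1})‖)⁻¹`, over all `n / 2` pairs. -/
def pairDensity (n : ℕ) (w : Phase n) : ℝ≥0∞ :=
  ∏ i : Fin (n / 2), (ENNReal.ofReal (norm2 (w.1 (fstIdx i)) (w.2 (fstIdx i)) *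
    norm2 (w.1 (sndIdx i)) (w.2 (sndIdx i))))⁻¹

/-- For even `n`, the kernel `∏ᵢ δ(sin (φ_i - ϕ_i)) / ∏ₖ ‖(x_k, u_k)‖`. -/
def evenKernel (n : ℕ) : Measure (Phase n) :=
  (delta (sinDiff n)).withDensity (pairDensity n)

/-- For odd `n`, the kernel
`∏ᵢ δ(sin (φ_i - ϕ_i)) / (|x_last - u_last| ∏_{k ≠ last} ‖(x_k, u_k)‖)`. -/
def oddKernel {n : ℕ} (hn : Odd n) : Measure (Phase n) :=
  (delta (sinDiff n)).withDensity fun w =>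
    pairDensity n w * (ENNReal.ofReal |w.1 (lastIdx hn) - w.2 (lastIdx hn)|)⁻¹

end Photography

end

noncomputable section

namespace Photography

/-! ### One-dimensional substitutions -/

/-! The ray used by the transform at the focal point of `z` passes through `z`. After the
substitution `u = z.2 - v` its points are `z - rays c (α, v)` (`ray_focal`), so the normal operator
at `z` integrates `f (z - rays c (α, v))` against `∏ₖ |α_{c k}|⁻¹ dα dv`. By Tonelli or Fubini it is
convolution with the image of `rayMeasure c` under `rays c`, and everything reduces to identifying
this image, one parameter at a time.

A parameter with one variable: for fixed `v`, the substitution `x = (1 - 1/α) v` has `x - v = -v/α`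
and `dx = |v| α⁻² dα`, so `|α|⁻¹ dα = |x - v|⁻¹ dx` (`measurePreserving_rayPoint`).

A parameter with two variables: `t = 1 - 1/α` absorbs `α⁻²`, and the points `(t v, v)`, `(t w, w)`
are `p` and `λ p` with `λ = w / v` and `dt dv dw = dp dλ` (`measurePreserving_rayPair`). To see the
delta function here, write `q = l √(1 - s²) p + |l| s p'` with `p'` orthogonal to `p` and of the
same length. Then `s` is the sine of the angle difference, `‖q‖ = |l| ‖p‖`, and `dq = |l| ‖p‖² / √(1
- s²) ds dl`. Setting `s = ε τ` cancels the `ε⁻¹` of the mollifier; dominated convergence leaves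
`‖p‖ ‖l p‖ dp dl` on proportional pairs (`isDelta_tildeDelta`). Division by the norms gives `dp dl`,
the image found above (`pairDelta_withDensity`).

Convergence: Schwartz decay bounds `f` by a product over the variables, and integration over `v`
leaves a factor of order `(1 + α²)^(-1/2)` per variable (`rayDensity_mul_lintegral_le`). A parameter
shared by two variables thus gets the integrable `(1 + α²)⁻¹`; for an unshared parameter this bound
is not integrable at infinity, whence the truncation `|α| ≤ A`, which reads `|v| ≤ A |y - v|` in
phase space. -/

theorem lintegral_affine {c : ℝ} (hc : c ≠ 0) (d : ℝ) (F : ℝ → ℝ≥0∞) :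
    ∫⁻ x, F x = ∫⁻ s, ENNReal.ofReal |c| * F (c * s + d) := by
  have h := lintegral_image_eq_lintegral_abs_deriv_mul (s := Set.univ) (f := fun s => c * s + d)
    (f' := fun _ => c) MeasurableSet.univ
    (fun x _ => by
      simpa only [id, mul_one] using
        (((hasDerivAt_id x).const_mul c).add_const d).hasDerivWithinAt)
    (fun x _ y _ hxy => by simpa [hc] using hxy) F
  have him : (fun s => c * s + d) '' Set.univ = Set.univ := by
    rw [Set.image_univ, Set.range_eq_univ]
    exact fun y => ⟨(y - d) / c, by field_simp; ring⟩
  simpa [him] using h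

theorem lintegral_inv (F : ℝ → ℝ≥0∞) :
    ∫⁻ x, F x = ∫⁻ α, ENNReal.ofReal ((α ^ 2)⁻¹) * F (1 / α) := by
  have h := lintegral_image_eq_lintegral_abs_deriv_mul (s := ({0}ᶜ : Set ℝ)) (f := fun s => s⁻¹)
    (f' := fun s => -(s ^ 2)⁻¹) (measurableSet_singleton 0).compl
    (fun x hx => (hasDerivAt_inv hx).hasDerivWithinAt)
    (fun x _ y _ hxy => inv_injective hxy) F
  have him : (fun s : ℝ => s⁻¹) '' {0}ᶜ = {0}ᶜ := by
    ext y
    constructor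
    · rintro ⟨x, hx, rfl⟩
      simpa using hx
    · exact fun hy => ⟨y⁻¹, by simpa using hy, inv_inv y⟩
  rw [him] at h
  simpa [restrict_compl_singleton, abs_of_nonneg] using h

theorem hasDerivAt_div_sqrt_one_sub_sq {s : ℝ} (hs : s ∈ Set.Ioo (-1 : ℝ) 1) :
    HasDerivAt (fun s : ℝ => s / √(1 - s ^ 2)) ((√(1 - s ^ 2) ^ 3)⁻¹) s := by
  have hpos : 0 < 1 - s ^ 2 := by nlinarith [hs.1, hs.2]
  have h1 : HasDerivAt (fun s : ℝ => 1 - s ^ 2) (-(2 * s)) s := by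
    simpa using ((hasDerivAt_pow 2 s).const_sub 1)
  have h2 := (hasDerivAt_id s).div (h1.sqrt hpos.ne') (Real.sqrt_pos.2 hpos).ne'
  refine HasDerivAt.congr_deriv h2 ?_
  have hq := Real.sqrt_pos.2 hpos
  have hsq := Real.sq_sqrt hpos.le
  simp only [id]
  field_simp
  nlinarith

/-- The tangent of an angle in `(-π/2, π/2)` as a function of its sine is an increasing bijection of
`(-1, 1)` onto the line. -/
theorem lintegral_div_sqrt_one_sub_sq (F : ℝ → ℝ≥0∞) :
    ∫⁻ x, F x = ∫⁻ s in Set.Ioo (-1 : ℝ) 1,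
      ENNReal.ofReal ((√(1 - s ^ 2) ^ 3)⁻¹) * F (s / √(1 - s ^ 2)) := by
  have h := lintegral_image_eq_lintegral_abs_deriv_mul (s := Set.Ioo (-1 : ℝ) 1)
    (f := fun s => s / √(1 - s ^ 2)) (f' := fun s => (√(1 - s ^ 2) ^ 3)⁻¹) measurableSet_Ioo
    (fun x hx => (hasDerivAt_div_sqrt_one_sub_sq hx).hasDerivWithinAt) ?_ F
  · have him : (fun s : ℝ => s / √(1 - s ^ 2)) '' Set.Ioo (-1) 1 = Set.univ := by
      refine Set.eq_univ_of_forall fun y => ⟨y / √(1 + y ^ 2), ?_, ?_⟩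
      · have : |y| < √(1 + y ^ 2) := Real.lt_sqrt_of_sq_lt (by rw [sq_abs]; linarith)
        rw [Set.mem_Ioo, ← abs_lt, abs_div, abs_of_nonneg (Real.sqrt_nonneg _),
          div_lt_one (by positivity)]
        exact this
      · have h0 : 0 < 1 + y ^ 2 := by positivity
        have : 1 - (y / √(1 + y ^ 2)) ^ 2 = (1 + y ^ 2)⁻¹ := by
          rw [div_pow, Real.sq_sqrt h0.le]; field_simp; ring
        simp only [this, Real.sqrt_inv]
        field_simp
    rw [him] at h
    rw [← setLIntegral_univ, h]
    refine setLIntegral_congr_fun measurableSet_Ioo fun s _ => ?_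
    rw [abs_of_nonneg (by positivity)]
  · have hmono : StrictMonoOn (fun s : ℝ => s / √(1 - s ^ 2)) (Set.Ioo (-1) 1) := by
      refine strictMonoOn_of_deriv_pos (convex_Ioo _ _)
        (fun s hs => (hasDerivAt_div_sqrt_one_sub_sq hs).continuousAt.continuousWithinAt) ?_
      intro s hs
      rw [interior_Ioo] at hs
      rw [(hasDerivAt_div_sqrt_one_sub_sq hs).deriv]
      have hpos : 0 < 1 - s ^ 2 := by nlinarith [hs.1, hs.2]
      positivity
    exact hmono.injOn

theorem lintegral_map_withDensity {X Y : Type*} [MeasurableSpace X] [MeasurableSpace Y]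
    {μ : Measure X} {T : X → Y} (hT : Measurable T) {d : X → ℝ≥0∞} (hd : Measurable d)
    {F : Y → ℝ≥0∞} (hF : Measurable F) :
    ∫⁻ y, F y ∂((μ.withDensity d).map T) = ∫⁻ x, d x * F (T x) ∂μ := by
  rw [lintegral_map hF hT, lintegral_withDensity_eq_lintegral_mul _ hd (by fun_prop)]
  rfl

theorem map_withDensity_comp {X Y : Type*} [MeasurableSpace X] [MeasurableSpace Y]
    {μ : Measure X} {T : X → Y} (hT : Measurable T) {d : Y → ℝ≥0∞} (hd : Measurable d) :
    (μ.map T).withDensity d = (μ.withDensity (d ∘ T)).map T := by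
  refine Measure.ext_of_lintegral _ fun F hF => ?_
  rw [lintegral_map_withDensity hT (hd.comp hT) hF,
    lintegral_withDensity_eq_lintegral_mul _ hd hF, lintegral_map (hd.mul hF) hT]
  rfl

theorem measurable_ofReal_abs_inv {X : Type*} [MeasurableSpace X] {h : X → ℝ} (hh : Measurable h) :
    Measurable fun x => (ENNReal.ofReal |h x|)⁻¹ :=
  (ENNReal.measurable_ofReal.comp (measurable_norm.comp hh)).inv

theorem ae_real_ne_zero : ∀ᵐ x : ℝ, x ≠ 0 := by
  simp [ae_iff]

/-! ### One pair of variables with its own parameter -/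

/-- The point `((1 - 1 / α) v, v)`. -/
def rayPoint (α v : ℝ) : ℝ × ℝ := ((1 - 1 / α) * v, v)

@[fun_prop]
theorem measurable_rayPoint : Measurable fun a : ℝ × ℝ => rayPoint a.1 a.2 := by
  unfold rayPoint; fun_prop

/-- `|α|⁻¹`, infinite at `0`. -/
def rayDensity (α : ℝ) : ℝ≥0∞ := (ENNReal.ofReal |α|)⁻¹

@[fun_prop]
theorem measurable_rayDensity : Measurable rayDensity := measurable_ofReal_abs_inv measurable_id

/-- `|x - u|⁻¹`, infinite on the diagonal. -/
def diagDensity (p : ℝ × ℝ) : ℝ≥0∞ := (ENNReal.ofReal |p.1 - p.2|)⁻¹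

@[fun_prop]
theorem measurable_diagDensity : Measurable diagDensity :=
  measurable_ofReal_abs_inv (measurable_fst.sub measurable_snd)

theorem rayDensity_ne_top {α : ℝ} (h : α ≠ 0) : rayDensity α ≠ ⊤ := by
  simp [rayDensity, h]

theorem rayDensity_eq_ofReal {α : ℝ} (h : α ≠ 0) : rayDensity α = ENNReal.ofReal |α|⁻¹ := by
  rw [rayDensity, ENNReal.ofReal_inv_of_pos (by positivity)]

/-- For fixed `u ≠ 0` put `x = u - u/α`: the Jacobian `|u| α⁻²` times `|x - u|⁻¹ = |α| / |u|` is
`|α|⁻¹`. -/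
theorem measurePreserving_rayPoint :
    MeasurePreserving (fun a : ℝ × ℝ => rayPoint a.1 a.2)
      (volume.withDensity fun a => rayDensity a.1) (volume.withDensity diagDensity) := by
  refine ⟨measurable_rayPoint, Measure.ext_of_lintegral _ fun F hF => ?_⟩
  rw [lintegral_map_withDensity measurable_rayPoint (by fun_prop) hF,
    lintegral_withDensity_eq_lintegral_mul _ measurable_diagDensity hF, Measure.volume_eq_prod,
    lintegral_prod_symm _ (by fun_prop), lintegral_prod_symm _ (by fun_prop)]
  refine lintegral_congr_ae (ae_real_ne_zero.mono fun u hu => ?_)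
  simp only [Pi.mul_apply]
  conv_rhs => rw [lintegral_affine (neg_ne_zero.2 hu) u, lintegral_inv]
  refine lintegral_congr_ae (ae_real_ne_zero.mono fun α hα => ?_)
  have h1 : diagDensity (-u * (1 / α) + u, u) = ENNReal.ofReal (|α| / |u|) := by
    rw [diagDensity, ← ENNReal.ofReal_inv_of_pos]
    · congr 1
      rw [show -u * (1 / α) + u - u = -(u / α) by ring, abs_neg, abs_div, inv_div]
    · rw [show -u * (1 / α) + u - u = -(u / α) by ring, abs_neg]
      positivity
  simp only
  rw [h1, rayDensity_eq_ofReal hα, ← mul_assoc, ← mul_assoc,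
    ← ENNReal.ofReal_mul (by positivity), ← ENNReal.ofReal_mul (by positivity)]
  congr 2
  · rw [abs_neg, ← sq_abs]
    have : |u| ≠ 0 := by simpa
    have : |α| ≠ 0 := by simpa
    field_simp
  · simp only [rayPoint, Prod.mk.injEq, and_true]
    ring

/-! ### Two pairs of variables with a common parameter -/

/-- The point `(p, λ p)` of two proportional vectors. -/
def propPair (b : (ℝ × ℝ) × ℝ) : (ℝ × ℝ) × (ℝ × ℝ) := (b.1, b.2 • b.1)

@[fun_prop]
theorem measurable_propPair : Measurable propPair := by unfold propPair; fun_prop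

/-- The kernel `δ(sin (φ - ϕ)) / (‖p‖ ‖q‖)` on pairs of plane vectors. -/
def pairKernel : Measure ((ℝ × ℝ) × (ℝ × ℝ)) := (volume : Measure ((ℝ × ℝ) × ℝ)).map propPair

/-- The pair of points `rayPoint α v₁`, `rayPoint α v₂`. -/
def rayPair (a : ℝ × (ℝ × ℝ)) : (ℝ × ℝ) × (ℝ × ℝ) := (rayPoint a.1 a.2.1, rayPoint a.1 a.2.2)

@[fun_prop]
theorem measurable_rayPair : Measurable rayPair := by unfold rayPair rayPoint; fun_prop

/-- The two points lie on a common line through the origin, whose slope parameter is `t = 1 - 1/α`.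
The density `α⁻²` is exactly the Jacobian of `t`, so no weight remains in the coordinates `(p, λ)`.
-/
theorem measurePreserving_rayPair :
    MeasurePreserving rayPair (volume.withDensity fun a => rayDensity a.1 * rayDensity a.1)
      pairKernel := by
  refine ⟨measurable_rayPair, Measure.ext_of_lintegral _ fun F hF => ?_⟩
  rw [lintegral_map_withDensity measurable_rayPair (by fun_prop) hF, pairKernel,
    lintegral_map hF measurable_propPair]
  calc
    _ = ∫⁻ α, ENNReal.ofReal ((α ^ 2)⁻¹) * ∫⁻ v : ℝ × ℝ,
          F (((1 - 1 / α) * v.1, v.1), ((1 - 1 / α) * v.2, v.2)) := by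
      rw [Measure.volume_eq_prod, lintegral_prod _ (by fun_prop)]
      refine lintegral_congr_ae (ae_real_ne_zero.mono fun α hα => ?_)
      simp only
      rw [lintegral_const_mul' _ _
        (ENNReal.mul_ne_top (rayDensity_ne_top hα) (rayDensity_ne_top hα)),
        rayDensity_eq_ofReal hα, ← ENNReal.ofReal_mul (by positivity), ← mul_inv, abs_mul_abs_self,
        sq]
      rfl
    _ = ∫⁻ t : ℝ, ∫⁻ v : ℝ × ℝ, F ((t * v.1, v.1), (t * v.2, v.2)) := by
      conv_rhs => rw [lintegral_affine (by norm_num : (-1 : ℝ) ≠ 0) 1, lintegral_inv]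
      refine lintegral_congr fun α => ?_
      have : -1 * (1 / α) + 1 = 1 - 1 / α := by ring
      simp only [this, abs_neg, abs_one, ENNReal.ofReal_one, one_mul]
    _ = ∫⁻ v : ℝ, ∫⁻ t : ℝ, ∫⁻ w : ℝ, F ((t * v, v), (t * w, w)) := by
      rw [lintegral_lintegral_swap (f := fun v t => ∫⁻ w : ℝ, F ((t * v, v), (t * w, w))) (by
        exact (Measurable.lintegral_prod_right' (f := fun a : (ℝ × ℝ) × ℝ =>
          F ((a.1.2 * a.1.1, a.1.1), (a.1.2 * a.2, a.2))) (by fun_prop)).aemeasurable)]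
      refine lintegral_congr fun t => ?_
      rw [Measure.volume_eq_prod, lintegral_prod _ (by fun_prop)]
    -- The substitutions `x = v t` and `w = v l` each contribute `|v|`, on opposite sides of the
    -- equation.
    _ = ∫⁻ v : ℝ, ∫⁻ x : ℝ, ∫⁻ l : ℝ, F ((x, v), l • (x, v)) := by
      refine lintegral_congr_ae (ae_real_ne_zero.mono fun v hv => ?_)
      simp only
      rw [lintegral_affine hv 0 (fun x => ∫⁻ l : ℝ, F ((x, v), l • (x, v)))]
      refine lintegral_congr fun t => ?_
      rw [lintegral_affine hv 0, lintegral_const_mul' _ _ (by simp)]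
      refine congrArg _ (lintegral_congr fun l => ?_)
      have : ((t * v, v), (t * (v * l), v * l)) = ((v * t, v), (l * (v * t), l * v)) := by
        simp only [Prod.mk.injEq]
        exact ⟨⟨by ring, trivial⟩, by ring, by ring⟩
      simp only [Prod.smul_mk, smul_eq_mul, add_zero, this]
    _ = _ := by
      rw [Measure.volume_eq_prod, lintegral_prod _ (by fun_prop), Measure.volume_eq_prod,
        lintegral_prod_symm _ (by
          exact (Measurable.lintegral_prod_right' (f := fun a : (ℝ × ℝ) × ℝ =>
            F (propPair a)) (by fun_prop)).aemeasurable)]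
      rfl

/-! ### Angular coordinates for a plane vector relative to another one -/

/-- The squared Euclidean norm. -/
def normSq (p : ℝ × ℝ) : ℝ := p.1 ^ 2 + p.2 ^ 2

@[fun_prop]
theorem continuous_normSq : Continuous normSq := by unfold normSq; fun_prop

theorem normSq_nonneg (p : ℝ × ℝ) : 0 ≤ normSq p := by unfold normSq; positivity

theorem normSq_pos {p : ℝ × ℝ} (hp : p ≠ 0) : 0 < normSq p := by
  rcases (normSq_nonneg p).lt_or_eq with h | h
  · exact h
  · refine absurd (Prod.ext ?_ ?_) hp <;> simp only [normSq] at h <;>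
      simp only [Prod.fst_zero, Prod.snd_zero] <;>
      nlinarith [sq_nonneg p.1, sq_nonneg p.2]

/-- The frame `p`, `(p.2, -p.1)` is orthogonal with equal lengths. Its second vector is oriented so
that its coordinate has the sign of the sine of the angle of `p` minus that of `q`. -/
theorem lintegral_plane_frame {p : ℝ × ℝ} (hp : p ≠ 0) {F : ℝ × ℝ → ℝ≥0∞} (hF : Measurable F) :
    ∫⁻ q, F q = ∫⁻ y : ℝ × ℝ, ENNReal.ofReal (normSq p) * F (y.1 • p + y.2 • (p.2, -p.1)) := by
  set T := Matrix.toLin (Module.Basis.finTwoProd ℝ) (Module.Basis.finTwoProd ℝ)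
    !![p.1, p.2; p.2, -p.1] with hT
  have hdet : LinearMap.det T = -normSq p := by
    rw [hT, LinearMap.det_toLin, Matrix.det_fin_two_of, normSq]; ring
  have hpos := normSq_pos hp
  have hmap := Measure.map_linearMap_addHaar_eq_smul_addHaar (volume : Measure (ℝ × ℝ))
    (f := T) (by rw [hdet]; linarith)
  have hTy : ∀ y : ℝ × ℝ, T y = y.1 • p + y.2 • (p.2, -p.1) := by
    intro y
    rw [hT, Matrix.toLin_finTwoProd_apply]
    ext <;> simp <;> ring
  have hTm : Measurable T := T.continuous_of_finiteDimensional.measurable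
  rw [lintegral_const_mul _ (by fun_prop)]
  simp_rw [← hTy]
  rw [← lintegral_map hF hTm, hmap, lintegral_smul_measure, hdet, smul_eq_mul, ← mul_assoc,
    ← ENNReal.ofReal_mul hpos.le, inv_neg, abs_neg, abs_inv, abs_of_pos hpos,
    mul_inv_cancel₀ hpos.ne']
  simp

/-- Polar coordinates with the sine `s` as angular variable and a signed radius `l`, whose sign
selects the half plane. The factor `|l|` in the second coordinate makes `s` the sine in both half
planes. -/
theorem lintegral_sector {F : ℝ × ℝ → ℝ≥0∞} (hF : Measurable F) :
    ∫⁻ y, F y = ∫⁻ s : ℝ, ∫⁻ l : ℝ,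
      ENNReal.ofReal (|l| / √(1 - s ^ 2)) * F (l * √(1 - s ^ 2), |l| * s) := by
  have hm : Measurable fun a : ℝ × ℝ => ENNReal.ofReal (|a.1| * (√(1 - a.2 ^ 2) ^ 3)⁻¹) *
      F (a.1, |a.1| * (a.2 / √(1 - a.2 ^ 2))) := by
    have : Measurable fun a : ℝ × ℝ => |a.1| := measurable_norm.comp measurable_fst
    fun_prop
  calc
    ∫⁻ y, F y = ∫⁻ a : ℝ, ∫⁻ s in Set.Ioo (-1 : ℝ) 1,
        ENNReal.ofReal (|a| * (√(1 - s ^ 2) ^ 3)⁻¹) * F (a, |a| * (s / √(1 - s ^ 2))) := by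
      rw [Measure.volume_eq_prod, lintegral_prod _ hF.aemeasurable]
      refine lintegral_congr_ae (ae_real_ne_zero.mono fun a ha => ?_)
      simp only
      conv_lhs => rw [lintegral_affine (abs_ne_zero.2 ha) 0, lintegral_div_sqrt_one_sub_sq]
      refine lintegral_congr fun s => ?_
      rw [← mul_assoc, ← ENNReal.ofReal_mul (by positivity), add_zero, abs_abs,
        mul_comm |a| (_⁻¹)]
    _ = ∫⁻ s in Set.Ioo (-1 : ℝ) 1, ∫⁻ a : ℝ,
        ENNReal.ofReal (|a| * (√(1 - s ^ 2) ^ 3)⁻¹) * F (a, |a| * (s / √(1 - s ^ 2))) :=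
      lintegral_lintegral_swap hm.aemeasurable
    _ = ∫⁻ s in Set.Ioo (-1 : ℝ) 1, ∫⁻ l : ℝ,
        ENNReal.ofReal (|l| / √(1 - s ^ 2)) * F (l * √(1 - s ^ 2), |l| * s) := by
      refine setLIntegral_congr_fun measurableSet_Ioo fun s hs => ?_
      have hpos : 0 < √(1 - s ^ 2) := Real.sqrt_pos.2 (by nlinarith [hs.1, hs.2])
      conv_lhs => rw [lintegral_affine hpos.ne' 0]
      refine lintegral_congr fun l => ?_
      rw [← mul_assoc, ← ENNReal.ofReal_mul (by positivity), add_zero, abs_mul,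
        abs_of_pos hpos]
      congr 2
      · field_simp
      · refine Prod.ext (mul_comm _ _) ?_
        simp only
        field_simp
    -- Outside `(-1, 1)` the square root is `0`, and division by zero makes the density vanish, so
    -- the integral extends to the whole line.
    _ = _ := by
      rw [← lintegral_indicator measurableSet_Ioo]
      refine lintegral_congr fun s => ?_
      by_cases hs : s ∈ Set.Ioo (-1 : ℝ) 1
      · rw [Set.indicator_of_mem hs]
      · rw [Set.indicator_of_notMem hs]
        have : √(1 - s ^ 2) = 0 := by
          refine Real.sqrt_eq_zero_of_nonpos ?_
          rw [Set.mem_Ioo, ← abs_lt, not_lt] at hs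
          rw [← sq_abs]
          nlinarith
        simp [this]

/-- The pair `(p, q)`, where `q` has the angular coordinate `ε τ` and the radial coordinate
`l` relative to `p`. -/
def rotPair (ε : ℝ) (c : (ℝ × ℝ) × (ℝ × ℝ)) : (ℝ × ℝ) × (ℝ × ℝ) :=
  (c.1, (c.2.1 * √(1 - (ε * c.2.2) ^ 2)) • c.1 + (|c.2.1| * (ε * c.2.2)) • (c.1.2, -c.1.1))

/-- The Jacobian of `rotPair`, up to a factor `ε`. -/
def rotDensity (ε : ℝ) (c : (ℝ × ℝ) × (ℝ × ℝ)) : ℝ :=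
  |c.2.1| * normSq c.1 / √(1 - (ε * c.2.2) ^ 2)

@[fun_prop]
theorem continuous_rotPair : Continuous fun e : ℝ × ((ℝ × ℝ) × (ℝ × ℝ)) => rotPair e.1 e.2 := by
  unfold rotPair; fun_prop

theorem continuous_rotPair_right (ε : ℝ) : Continuous (rotPair ε) :=
  continuous_rotPair.comp (Continuous.prodMk_right ε)

@[fun_prop]
theorem measurable_rotPair (ε : ℝ) : Measurable (rotPair ε) :=
  (continuous_rotPair_right ε).measurable

@[fun_prop]
theorem measurable_rotDensity (ε : ℝ) : Measurable (rotDensity ε) := by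
  unfold rotDensity
  refine Measurable.div (Continuous.measurable ?_) (Continuous.measurable ?_) <;> fun_prop

theorem rotDensity_nonneg (ε : ℝ) (c : (ℝ × ℝ) × (ℝ × ℝ)) : 0 ≤ rotDensity ε c := by
  have := normSq_nonneg c.1
  unfold rotDensity
  positivity

theorem ae_plane_ne_zero : ∀ᵐ p : ℝ × ℝ, p ≠ 0 := by
  simp [ae_iff]

/-- Frame relative to `p`, then sector coordinates, then `s = ε τ`. The explicit factor `ε` is the
one that cancels the `ε⁻¹` of the mollifier. -/
theorem measurePreserving_rotPair {ε : ℝ} (hε : 0 < ε) :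
    MeasurePreserving (rotPair ε)
      (volume.withDensity fun c => ENNReal.ofReal (ε * rotDensity ε c)) volume := by
  refine ⟨measurable_rotPair ε, Measure.ext_of_lintegral _ fun F hF => ?_⟩
  rw [lintegral_map_withDensity (measurable_rotPair ε) (by fun_prop) hF, Measure.volume_eq_prod,
    lintegral_prod _ (by fun_prop), lintegral_prod _ (by fun_prop)]
  refine lintegral_congr_ae (ae_plane_ne_zero.mono fun p hp => ?_)
  simp only
  conv_rhs => rw [lintegral_plane_frame hp (by fun_prop), lintegral_sector (by fun_prop),
    lintegral_affine hε.ne' 0]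
  rw [Measure.volume_eq_prod, lintegral_prod_symm _ (by fun_prop)]
  refine lintegral_congr fun τ => ?_
  rw [← lintegral_const_mul' _ _ (by simp)]
  refine lintegral_congr fun l => ?_
  have := normSq_nonneg p
  simp only [add_zero]
  rw [← mul_assoc, ← mul_assoc, ← ENNReal.ofReal_mul (by positivity),
    ← ENNReal.ofReal_mul (by positivity), abs_of_pos hε]
  congr 2
  simp only [rotDensity]
  ring

/-! ### The measure `δ(sin (φ - ϕ))` on pairs of plane vectors -/

/-- The density `‖p‖ ‖λ p‖` in the coordinates `(p, λ)` of proportional pairs. -/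
def propDensity (b : (ℝ × ℝ) × ℝ) : ℝ := |b.2| * normSq b.1

@[fun_prop]
theorem continuous_propDensity : Continuous propDensity := by unfold propDensity; fun_prop

theorem propDensity_nonneg (b : (ℝ × ℝ) × ℝ) : 0 ≤ propDensity b :=
  mul_nonneg (abs_nonneg _) (normSq_nonneg _)

/-- The measure `δ(sin (φ - ϕ))` on pairs of plane vectors. -/
def pairDelta : Measure ((ℝ × ℝ) × (ℝ × ℝ)) :=
  ((volume : Measure ((ℝ × ℝ) × ℝ)).withDensity fun b =>
    ENNReal.ofReal (propDensity b)).map propPair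

theorem IsMollifier.lintegral_eq_one {ρ : ℝ → ℝ} (hρ : IsMollifier ρ) :
    ∫⁻ t, ENNReal.ofReal (ρ t) = 1 := by
  rw [← ofReal_integral_eq_lintegral_ofReal
    (hρ.smooth.continuous.integrable_of_hasCompactSupport hρ.compact) (ae_of_all _ hρ.nonneg),
    hρ.integral_eq_one, ENNReal.ofReal_one]

/-- At `ε = 0` the map forgets `τ`, so `ρ` integrates out to `1`. This puts the limit in the same
coordinates as the approximations and shows that it does not depend on `ρ`. -/
theorem measurePreserving_rotPair_zero {ρ : ℝ → ℝ} (hρ : IsMollifier ρ) :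
    MeasurePreserving (rotPair 0)
      (volume.withDensity fun c => ENNReal.ofReal (ρ c.2.2 * rotDensity 0 c)) pairDelta := by
  have hρm : Measurable ρ := hρ.smooth.continuous.measurable
  refine ⟨measurable_rotPair 0, Measure.ext_of_lintegral _ fun F hF => ?_⟩
  rw [pairDelta, lintegral_map_withDensity measurable_propPair (by fun_prop) hF,
    lintegral_map_withDensity (measurable_rotPair 0) (by fun_prop) hF, Measure.volume_eq_prod,
    lintegral_prod _ (by fun_prop), Measure.volume_eq_prod (ℝ × ℝ) ℝ,
    lintegral_prod _ (by fun_prop)]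
  refine lintegral_congr fun p => ?_
  rw [Measure.volume_eq_prod, lintegral_prod _ (by fun_prop)]
  refine lintegral_congr fun l => ?_
  simp only [rotDensity, rotPair, zero_mul, ne_eq, OfNat.ofNat_ne_zero, not_false_eq_true,
    zero_pow, sub_zero, Real.sqrt_one, div_one, mul_one, mul_zero, zero_smul, add_zero]
  simp_rw [ENNReal.ofReal_mul (hρ.nonneg _)]
  rw [lintegral_mul_const _ (by fun_prop), lintegral_mul_const _ (by fun_prop),
    hρ.lintegral_eq_one, one_mul]
  rfl

/-! ### Product measures with densities -/

theorem lintegral_fin_nat_prod_eq_prod {N : ℕ} {E : Fin N → Type*} [∀ i, MeasurableSpace (E i)]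
    (μ : ∀ i, Measure (E i)) [∀ i, SigmaFinite (μ i)] (f : ∀ i, E i → ℝ≥0∞)
    (hf : ∀ i, Measurable (f i)) :
    ∫⁻ x, ∏ i, f i (x i) ∂(Measure.pi μ) = ∏ i, ∫⁻ x, f i x ∂(μ i) := by
  induction N with
  | zero => simp
  | succ N ih =>
    rw [← ((measurePreserving_piFinSuccAbove μ 0).symm).lintegral_comp_emb
      (MeasurableEquiv.measurableEmbedding _)]
    simp_rw [MeasurableEquiv.piFinSuccAbove_symm_apply, Fin.insertNthEquiv,
      Fin.prod_univ_succ, Fin.insertNth_zero]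
    rw [← ih (fun i => μ i.succ) (fun i => f i.succ) (fun i => hf _)]
    exact lintegral_prod_mul (μ := μ 0) (ν := Measure.pi fun i : Fin N => μ i.succ)
      (g := fun x => ∏ i : Fin N, f i.succ (x i)) (hf 0).aemeasurable
      (Finset.measurable_prod _ fun i _ => (hf _).comp (measurable_pi_apply i)).aemeasurable

theorem lintegral_fintype_prod_eq_prod {ι : Type*} [Fintype ι] {E : ι → Type*}
    [∀ i, MeasurableSpace (E i)] (μ : ∀ i, Measure (E i)) [∀ i, SigmaFinite (μ i)]
    (f : ∀ i, E i → ℝ≥0∞) (hf : ∀ i, Measurable (f i)) :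
    ∫⁻ x, ∏ i, f i (x i) ∂(Measure.pi μ) = ∏ i, ∫⁻ x, f i x ∂(μ i) := by
  let e := (Fintype.equivFin ι).symm
  rw [← (measurePreserving_piCongrLeft _ e).lintegral_comp_emb
    (MeasurableEquiv.measurableEmbedding _)]
  simp_rw [← e.prod_comp, MeasurableEquiv.coe_piCongrLeft, Equiv.piCongrLeft_apply_apply]
  exact lintegral_fin_nat_prod_eq_prod _ (fun i => f (e i)) fun i => hf _

theorem pi_withDensity {ι : Type*} [Fintype ι] {E : ι → Type*}
    [∀ i, MeasurableSpace (E i)] (μ : ∀ i, Measure (E i)) [∀ i, SigmaFinite (μ i)]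
    (f : ∀ i, E i → ℝ≥0∞) (hf : ∀ i, Measurable (f i))
    [∀ i, SigmaFinite ((μ i).withDensity (f i))] :
    Measure.pi (fun i => (μ i).withDensity (f i)) =
      (Measure.pi μ).withDensity fun x => ∏ i, f i (x i) := by
  refine Measure.pi_eq fun s hs => ?_
  rw [withDensity_apply _ (MeasurableSet.univ_pi hs),
    ← lintegral_indicator (MeasurableSet.univ_pi hs)]
  simp_rw [withDensity_apply _ (hs _), ← lintegral_indicator (hs _)]
  rw [← lintegral_fintype_prod_eq_prod _ _ fun i => (hf i).indicator (hs i)]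
  refine lintegral_congr fun x => ?_
  by_cases hx : x ∈ Set.univ.pi s
  · rw [Set.indicator_of_mem hx]
    exact Finset.prod_congr rfl fun i hi => by
      rw [Set.indicator_of_mem (hx i (Set.mem_univ i))]
  · rw [Set.indicator_of_notMem hx]
    obtain ⟨i, hi⟩ : ∃ i, x i ∉ s i := by simpa using hx
    exact (Finset.prod_eq_zero (Finset.mem_univ i) (Set.indicator_of_notMem hi _)).symm

/-! ### Regrouping of coordinates -/

/-- The indices of the variables as first and second elements of pairs and a possible last
element. -/
def indexEquiv (n : ℕ) : (Fin (n / 2) ⊕ Fin (n / 2)) ⊕ Fin (n % 2) ≃ Fin n where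
  toFun := Sum.elim (Sum.elim fstIdx sndIdx) fun j => ⟨n - 1, by have := j.2; omega⟩
  invFun k := if h : (k : ℕ) < 2 * (n / 2) then
      (if (k : ℕ) % 2 = 0 then .inl (.inl ⟨k / 2, by omega⟩) else .inl (.inr ⟨k / 2, by omega⟩))
    else .inr ⟨0, by have := k.2; omega⟩
  left_inv := by
    rintro ((i | i) | j)
    · have := i.2
      simp [fstIdx, this]
    · have := i.2
      have h : 2 * (i : ℕ) + 1 < 2 * (n / 2) := by omega
      have h' : (2 * (i : ℕ) + 1) / 2 = i := by omega
      simp [sndIdx, h, h', Nat.add_mod]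
    · have := j.2
      have h : ¬ (n - 1 < 2 * (n / 2)) := by omega
      refine (dif_neg h).trans (congrArg Sum.inr (Fin.ext ?_))
      simp only
      omega
  right_inv k := by
    have := k.2
    simp only
    split_ifs with h h' <;> simp only [Sum.elim_inl, Sum.elim_inr, fstIdx, sndIdx, Fin.ext_iff] <;>
      omega

/-- The parameters of the pairs and of a possible last variable. -/
def paramEquiv (n : ℕ) : Fin (n / 2) ⊕ Fin (n % 2) ≃ Fin ((n + 1) / 2) where
  toFun := Sum.elim (fun i => ⟨i, by omega⟩) fun j => ⟨n / 2, by have := j.2; omega⟩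
  invFun k := if h : (k : ℕ) < n / 2 then .inl ⟨k, h⟩ else .inr ⟨0, by have := k.2; omega⟩
  left_inv := by
    rintro (i | j)
    · simp
    · have := j.2
      refine (dif_neg (lt_irrefl _)).trans (congrArg Sum.inr (Fin.ext ?_))
      simp only
      omega
  right_inv k := by
    have := k.2
    simp only
    split_ifs with h <;> simp only [Sum.elim_inl, Sum.elim_inr, Fin.ext_iff]
    omega

theorem tildeCoupling_indexEquiv_fst {n : ℕ} (i : Fin (n / 2)) :
    tildeCoupling n (indexEquiv n (.inl (.inl i))) = paramEquiv n (.inl i) := by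
  simp [tildeCoupling, indexEquiv, paramEquiv, fstIdx]

theorem tildeCoupling_indexEquiv_snd {n : ℕ} (i : Fin (n / 2)) :
    tildeCoupling n (indexEquiv n (.inl (.inr i))) = paramEquiv n (.inl i) := by
  simp only [tildeCoupling, indexEquiv, paramEquiv, sndIdx, Equiv.coe_fn_mk, Sum.elim_inl,
    Sum.elim_inr, Fin.ext_iff]
  omega

theorem tildeCoupling_indexEquiv_last {n : ℕ} (j : Fin (n % 2)) :
    tildeCoupling n (indexEquiv n (.inr j)) = paramEquiv n (.inr j) := by
  have := j.2
  simp only [tildeCoupling, indexEquiv, paramEquiv, Equiv.coe_fn_mk, Sum.elim_inr, Fin.ext_iff]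
  omega

/-- Functions on a disjoint union, up to relabelling, as pairs of functions. -/
def glueEquiv {ι ι' κ : Type} (e : ι ⊕ ι' ≃ κ) (X : Type) [MeasurableSpace X] :
    (ι → X) × (ι' → X) ≃ᵐ (κ → X) :=
  (MeasurableEquiv.sumPiEquivProdPi fun _ : ι ⊕ ι' => X).symm.trans
    (MeasurableEquiv.piCongrLeft (fun _ => X) e)

section Glue

variable {ι ι' κ : Type} (e : ι ⊕ ι' ≃ κ) (X : Type)

theorem measurePreserving_glueEquiv [Fintype ι] [Fintype ι'] [Fintype κ]
    [MeasureSpace X] [SigmaFinite (volume : Measure X)] :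
    MeasurePreserving (glueEquiv e X) :=
  (volume_measurePreserving_sumPiEquivProdPi_symm fun _ : ι ⊕ ι' => X).trans
    (volume_measurePreserving_piCongrLeft (fun _ => X) e)

@[simp]
theorem glueEquiv_apply_inl [MeasurableSpace X] (a : (ι → X) × (ι' → X)) (i : ι) :
    glueEquiv e X a (e (.inl i)) = a.1 i := by
  simp [glueEquiv, MeasurableEquiv.coe_piCongrLeft, Equiv.piCongrLeft_apply_apply]
  rfl

@[simp]
theorem glueEquiv_apply_inr [MeasurableSpace X] (a : (ι → X) × (ι' → X)) (i : ι') :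
    glueEquiv e X a (e (.inr i)) = a.2 i := by
  simp [glueEquiv, MeasurableEquiv.coe_piCongrLeft, Equiv.piCongrLeft_apply_apply]
  rfl

end Glue

/-! ### Finiteness of `pairDelta` -/

theorem normSq_le (p : ℝ × ℝ) : normSq p ≤ 2 * ‖p‖ ^ 2 := by
  have h1 : ‖p.1‖ ≤ ‖p‖ := norm_fst_le p
  have h2 : ‖p.2‖ ≤ ‖p‖ := norm_snd_le p
  rw [Real.norm_eq_abs] at h1 h2
  unfold normSq
  rw [← sq_abs p.1, ← sq_abs p.2]
  nlinarith [abs_nonneg p.1, abs_nonneg p.2]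

/-- For fixed `p ≠ 0` in the ball, the admissible `λ` form an interval of length `2 R / ‖p‖` on
which the density is at most `2 R ‖p‖`. The product `4 R²` is independent of `p`, so the long
intervals near `p = 0` do no harm. -/
theorem pairDelta_closedBall_lt_top (R : ℝ) :
    pairDelta (Metric.closedBall 0 R) < ⊤ := by
  rcases lt_or_ge R 0 with hR | hR
  · simp [Metric.closedBall_eq_empty.2 hR]
  rw [← lintegral_indicator_one Metric.isClosed_closedBall.measurableSet, pairDelta,
    lintegral_map_withDensity measurable_propPair (by fun_prop)
      (measurable_one.indicator Metric.isClosed_closedBall.measurableSet),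
    Measure.volume_eq_prod, lintegral_prod _ (by
      refine (Measurable.mul (by fun_prop) ?_).aemeasurable
      exact (measurable_one.indicator Metric.isClosed_closedBall.measurableSet).comp
        measurable_propPair)]
  calc
    _ ≤ ∫⁻ p : ℝ × ℝ, (Metric.closedBall (0 : ℝ × ℝ) R).indicator
          (fun _ => ENNReal.ofReal (4 * R ^ 2)) p := by
      refine lintegral_mono_ae (ae_plane_ne_zero.mono fun p hp => ?_)
      have hp0 : 0 < ‖p‖ := norm_pos_iff.2 hp
      by_cases hpR : ‖p‖ ≤ R
      · rw [Set.indicator_of_mem (by simpa using hpR)]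
        calc
          _ ≤ ∫⁻ l : ℝ, (Set.Icc (-(R / ‖p‖)) (R / ‖p‖)).indicator
                (fun _ => ENNReal.ofReal (2 * R * ‖p‖)) l := by
            refine lintegral_mono fun l => ?_
            by_cases hl : |l| * ‖p‖ ≤ R
            · have hmem : l ∈ Set.Icc (-(R / ‖p‖)) (R / ‖p‖) := by
                rw [Set.mem_Icc, ← abs_le, le_div_iff₀ hp0]
                exact hl
              rw [Set.indicator_of_mem hmem]
              have h1 : (Metric.closedBall (0 : (ℝ × ℝ) × (ℝ × ℝ)) R).indicator
                  (1 : (ℝ × ℝ) × (ℝ × ℝ) → ℝ≥0∞) (propPair (p, l)) ≤ 1 :=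
                Set.indicator_apply_le' (fun _ => le_rfl) fun _ => zero_le
              refine (mul_le_of_le_one_right zero_le h1).trans (ENNReal.ofReal_le_ofReal ?_)
              have := normSq_le p
              simp only [propDensity]
              nlinarith [abs_nonneg l, mul_nonneg (abs_nonneg l) hp0.le]
            · have hmem : propPair (p, l) ∉ Metric.closedBall (0 : (ℝ × ℝ) × (ℝ × ℝ)) R := by
                rw [mem_closedBall_zero_iff, propPair, Prod.norm_def, max_le_iff, norm_smul]
                exact fun h => hl h.2
              simp [Set.indicator_of_notMem hmem]
          _ = ENNReal.ofReal (4 * R ^ 2) := by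
            rw [lintegral_indicator_const measurableSet_Icc, Real.volume_Icc,
              ← ENNReal.ofReal_mul (by positivity)]
            congr 1
            field_simp
            ring
          _ ≤ _ := le_rfl
      · rw [Set.indicator_of_notMem (by simpa using hpR)]
        refine (lintegral_eq_zero_of_ae_eq_zero (ae_of_all _ fun l => ?_)).le
        have hmem : propPair (p, l) ∉ Metric.closedBall (0 : (ℝ × ℝ) × (ℝ × ℝ)) R := by
          rw [mem_closedBall_zero_iff, propPair, Prod.norm_def, max_le_iff]
          exact fun h => hpR h.1
        simp [Set.indicator_of_notMem hmem]
    _ < ⊤ := by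
      rw [lintegral_indicator_const Metric.isClosed_closedBall.measurableSet]
      exact ENNReal.mul_lt_top ENNReal.ofReal_lt_top
        (isCompact_closedBall (0 : ℝ × ℝ) R).measure_lt_top

instance : IsFiniteMeasureOnCompacts pairDelta where
  lt_top_of_isCompact K hK := by
    obtain ⟨R, hR⟩ := hK.isBounded.subset_closedBall 0
    exact (measure_mono hR).trans_lt (pairDelta_closedBall_lt_top R)

/-- `(‖p‖ ‖q‖)⁻¹`, infinite if one of the vectors vanishes. -/
def pairWeight (a : (ℝ × ℝ) × (ℝ × ℝ)) : ℝ≥0∞ :=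
  (ENNReal.ofReal (norm2 a.1.1 a.1.2 * norm2 a.2.1 a.2.2))⁻¹

@[fun_prop]
theorem measurable_pairWeight : Measurable pairWeight := by
  unfold pairWeight norm2
  exact (ENNReal.measurable_ofReal.comp (by fun_prop)).inv

theorem norm2_mul_norm2_propPair (b : (ℝ × ℝ) × ℝ) :
    norm2 (propPair b).1.1 (propPair b).1.2 * norm2 (propPair b).2.1 (propPair b).2.2 =
      propDensity b := by
  have h : (b.2 * b.1.1) ^ 2 + (b.2 * b.1.2) ^ 2 = b.2 ^ 2 * normSq b.1 := by
    unfold normSq; ring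
  simp only [propPair, norm2, Prod.smul_fst, Prod.smul_snd, smul_eq_mul, propDensity, h]
  rw [Real.sqrt_mul (sq_nonneg _), Real.sqrt_sq_eq_abs, mul_left_comm]
  exact congrArg _ (Real.mul_self_sqrt (normSq_nonneg _))

theorem ae_propDensity_pos : ∀ᵐ b : (ℝ × ℝ) × ℝ, 0 < propDensity b := by
  have h1 : ∀ᵐ b : (ℝ × ℝ) × ℝ, b.1 ≠ 0 := Measure.quasiMeasurePreserving_fst.ae ae_plane_ne_zero
  have h2 : ∀ᵐ b : (ℝ × ℝ) × ℝ, b.2 ≠ 0 := Measure.quasiMeasurePreserving_snd.ae ae_real_ne_zero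
  filter_upwards [h1, h2] with b hb1 hb2
  exact mul_pos (abs_pos.2 hb2) (normSq_pos hb1)

/-- On proportional pairs the product of the two norms is the density of `pairDelta`, which is
positive almost everywhere and therefore cancels. -/
theorem pairDelta_withDensity : pairDelta.withDensity pairWeight = pairKernel := by
  rw [pairDelta, map_withDensity_comp measurable_propPair measurable_pairWeight,
    ← withDensity_mul _ (by fun_prop) (measurable_pairWeight.comp measurable_propPair), pairKernel]
  congr 1
  conv_rhs => rw [← withDensity_one (μ := (volume : Measure ((ℝ × ℝ) × ℝ)))]
  refine withDensity_congr_ae (ae_propDensity_pos.mono fun b hb => ?_)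
  simp only [Pi.mul_apply, Function.comp_apply, pairWeight, norm2_mul_norm2_propPair,
    Pi.one_apply]
  exact ENNReal.mul_inv_cancel (by simpa using hb) ENNReal.ofReal_ne_top

instance : SigmaFinite pairKernel := by
  rw [← pairDelta_withDensity]
  refine SigmaFinite.withDensity_of_ne_top ?_
  have hs : MeasurableSet {x | pairWeight x ≠ ⊤} :=
    (measurable_pairWeight (measurableSet_singleton ⊤)).compl
  rw [pairDelta, ae_map_iff measurable_propPair.aemeasurable hs]
  refine (withDensity_absolutelyContinuous _ _).ae_le (ae_propDensity_pos.mono fun b hb => ?_)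
  simpa [pairWeight, norm2_mul_norm2_propPair] using hb

theorem ae_fst_ne_snd : ∀ᵐ p : ℝ × ℝ, p.1 ≠ p.2 := by
  have h := Measure.ae_prod_mem_iff_ae_ae_mem (μ := (volume : Measure ℝ))
    (ν := (volume : Measure ℝ)) (s := {p | p.1 ≠ p.2})
    (measurableSet_eq_fun measurable_fst measurable_snd).compl
  refine h.2 (ae_of_all _ fun x => ?_)
  simp [ae_iff]

instance : SigmaFinite ((volume : Measure (ℝ × ℝ)).withDensity diagDensity) := by
  refine SigmaFinite.withDensity_of_ne_top (ae_fst_ne_snd.mono fun p hp => ?_)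
  simpa [diagDensity, sub_eq_zero] using hp

/-! ### Phase space and ray space as products over the pairs and a possible last variable. -/

theorem measurePreserving_prodProdProdComm (A B C D : Type) [MeasureSpace A] [MeasureSpace B]
    [MeasureSpace C] [MeasureSpace D] [SFinite (volume : Measure A)] [SFinite (volume : Measure B)]
    [SFinite (volume : Measure C)] [SFinite (volume : Measure D)] :
    MeasurePreserving fun a : (A × B) × (C × D) => ((a.1.1, a.2.1), (a.1.2, a.2.2)) := by
  have assoc (X Y Z : Type) [MeasureSpace X] [MeasureSpace Y] [MeasureSpace Z]
      [SFinite (volume : Measure X)] [SFinite (volume : Measure Y)]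
      [SFinite (volume : Measure Z)] :
      MeasurePreserving (MeasurableEquiv.prodAssoc : (X × Y) × Z ≃ᵐ X × (Y × Z)) :=
    ⟨MeasurableEquiv.prodAssoc.measurable, Measure.prodAssoc_prod⟩
  have h1 := assoc A B (C × D)
  have h2 := (MeasurePreserving.id (volume : Measure A)).prod ((assoc B C D).symm)
  have h3 := (MeasurePreserving.id (volume : Measure A)).prod
    ((Measure.measurePreserving_swap (μ := (volume : Measure B)) (ν := (volume : Measure C))).prod
      (MeasurePreserving.id (volume : Measure D)))
  have h4 := (MeasurePreserving.id (volume : Measure A)).prod (assoc C B D)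
  have h5 := (assoc A C (B × D)).symm
  exact h5.comp (h4.comp (h3.comp (h2.comp h1)))

/-- Phase space as a product over the pairs of variables and a possible last variable. -/
def phaseOf (n : ℕ) :
    (Fin (n / 2) → (ℝ × ℝ) × (ℝ × ℝ)) × (Fin (n % 2) → ℝ × ℝ) → Phase n :=
  MeasurableEquiv.arrowProdEquivProdArrow ℝ ℝ (Fin n) ∘
    glueEquiv (indexEquiv n) (ℝ × ℝ) ∘
    Prod.map (glueEquiv (Equiv.refl _) (ℝ × ℝ) ∘
      MeasurableEquiv.arrowProdEquivProdArrow (ℝ × ℝ) (ℝ × ℝ) (Fin (n / 2))) id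

theorem measurePreserving_phaseOf (n : ℕ) : MeasurePreserving (phaseOf n) :=
  (volume_measurePreserving_arrowProdEquivProdArrow ℝ ℝ (Fin n)).comp <|
    (measurePreserving_glueEquiv (indexEquiv n) (ℝ × ℝ)).comp <|
      ((measurePreserving_glueEquiv _ (ℝ × ℝ)).comp
        (volume_measurePreserving_arrowProdEquivProdArrow (ℝ × ℝ) (ℝ × ℝ) (Fin (n / 2)))).prod
        (MeasurePreserving.id _)

theorem phaseOf_fst {n : ℕ} (a : (Fin (n / 2) → (ℝ × ℝ) × (ℝ × ℝ)) × (Fin (n % 2) → ℝ × ℝ))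
    (i : Fin (n / 2)) :
    ((phaseOf n a).1 (indexEquiv n (.inl (.inl i))), (phaseOf n a).2 (indexEquiv n (.inl (.inl i))))
      = (a.1 i).1 := by
  change glueEquiv (indexEquiv n) (ℝ × ℝ) _ (indexEquiv n (.inl (.inl i))) = _
  rw [glueEquiv_apply_inl]
  exact glueEquiv_apply_inl (Equiv.refl (Fin (n / 2) ⊕ Fin (n / 2))) _ _ i

theorem phaseOf_snd {n : ℕ} (a : (Fin (n / 2) → (ℝ × ℝ) × (ℝ × ℝ)) × (Fin (n % 2) → ℝ × ℝ))
    (i : Fin (n / 2)) :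
    ((phaseOf n a).1 (indexEquiv n (.inl (.inr i))), (phaseOf n a).2 (indexEquiv n (.inl (.inr i))))
      = (a.1 i).2 := by
  change glueEquiv (indexEquiv n) (ℝ × ℝ) _ (indexEquiv n (.inl (.inr i))) = _
  rw [glueEquiv_apply_inl]
  exact glueEquiv_apply_inr (Equiv.refl (Fin (n / 2) ⊕ Fin (n / 2))) _ _ i

theorem phaseOf_last {n : ℕ} (a : (Fin (n / 2) → (ℝ × ℝ) × (ℝ × ℝ)) × (Fin (n % 2) → ℝ × ℝ))
    (j : Fin (n % 2)) :
    ((phaseOf n a).1 (indexEquiv n (.inr j)), (phaseOf n a).2 (indexEquiv n (.inr j)))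
      = a.2 j := by
  change glueEquiv (indexEquiv n) (ℝ × ℝ) _ (indexEquiv n (.inr j)) = _
  rw [glueEquiv_apply_inr]
  rfl

/-- The pairs of a parameter vector and a vector of variables as a product over the parameters. -/
def raysOf (n : ℕ) :
    (Fin (n / 2) → ℝ × (ℝ × ℝ)) × (Fin (n % 2) → ℝ × ℝ) →
      (Fin ((n + 1) / 2) → ℝ) × (Fin n → ℝ) :=
  Prod.map (glueEquiv (paramEquiv n) ℝ)
      (glueEquiv (indexEquiv n) ℝ ∘ Prod.map (glueEquiv (Equiv.refl _) ℝ ∘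
        MeasurableEquiv.arrowProdEquivProdArrow ℝ ℝ (Fin (n / 2))) id) ∘
    (fun a => ((a.1.1, a.2.1), (a.1.2, a.2.2))) ∘
    Prod.map (MeasurableEquiv.arrowProdEquivProdArrow ℝ (ℝ × ℝ) (Fin (n / 2)))
      (MeasurableEquiv.arrowProdEquivProdArrow ℝ ℝ (Fin (n % 2)))

theorem measurePreserving_raysOf (n : ℕ) : MeasurePreserving (raysOf n) :=
  ((measurePreserving_glueEquiv (paramEquiv n) ℝ).prod
    ((measurePreserving_glueEquiv (indexEquiv n) ℝ).comp <|
      ((measurePreserving_glueEquiv _ ℝ).comp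
        (volume_measurePreserving_arrowProdEquivProdArrow ℝ ℝ (Fin (n / 2)))).prod
        (MeasurePreserving.id _))).comp <|
  (measurePreserving_prodProdProdComm _ _ _ _).comp <|
  (volume_measurePreserving_arrowProdEquivProdArrow ℝ (ℝ × ℝ) (Fin (n / 2))).prod
    (volume_measurePreserving_arrowProdEquivProdArrow ℝ ℝ (Fin (n % 2)))

section RaysOf

variable {n : ℕ} (a : (Fin (n / 2) → ℝ × (ℝ × ℝ)) × (Fin (n % 2) → ℝ × ℝ))

theorem raysOf_param (i : Fin (n / 2)) :
    (raysOf n a).1 (paramEquiv n (.inl i)) = (a.1 i).1 :=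
  glueEquiv_apply_inl _ _ _ i

theorem raysOf_param_last (j : Fin (n % 2)) :
    (raysOf n a).1 (paramEquiv n (.inr j)) = (a.2 j).1 :=
  glueEquiv_apply_inr _ _ _ j

theorem raysOf_fst (i : Fin (n / 2)) :
    (raysOf n a).2 (indexEquiv n (.inl (.inl i))) = (a.1 i).2.1 :=
  (glueEquiv_apply_inl (indexEquiv n) _ _ _).trans
    (glueEquiv_apply_inl (Equiv.refl (Fin (n / 2) ⊕ Fin (n / 2))) _ _ i)

theorem raysOf_snd (i : Fin (n / 2)) :
    (raysOf n a).2 (indexEquiv n (.inl (.inr i))) = (a.1 i).2.2 :=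
  (glueEquiv_apply_inl (indexEquiv n) _ _ _).trans
    (glueEquiv_apply_inr (Equiv.refl (Fin (n / 2) ⊕ Fin (n / 2))) _ _ i)

theorem raysOf_last (j : Fin (n % 2)) :
    (raysOf n a).2 (indexEquiv n (.inr j)) = (a.2 j).2 :=
  glueEquiv_apply_inr _ _ _ j

end RaysOf

theorem prod_indexEquiv {n : ℕ} {M : Type*} [CommMonoid M] (g : Fin n → M) :
    ∏ k, g k = (∏ i, g (indexEquiv n (.inl (.inl i))) * g (indexEquiv n (.inl (.inr i)))) *
      ∏ j, g (indexEquiv n (.inr j)) := by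
  rw [← (indexEquiv n).prod_comp, Fintype.prod_sum_type, Fintype.prod_sum_type,
    Finset.prod_mul_distrib]

/-! ### Rays and kernels -/

section Rays

variable {n : ℕ} {ι : Type}

/-- The point `(((1 - 1 / α_{c k}) v_k)_k, v)`. -/
def rays (c : Fin n → ι) (a : (ι → ℝ) × (Fin n → ℝ)) : Phase n :=
  (fun k => (1 - 1 / a.1 (c k)) * a.2 k, a.2)

/-- `∏ₖ |α_{c k}|⁻¹`. -/
def couplingDensity (c : Fin n → ι) (α : ι → ℝ) : ℝ≥0∞ := ∏ k, rayDensity (α (c k))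

@[fun_prop]
theorem measurable_couplingDensity (c : Fin n → ι) : Measurable (couplingDensity c) := by
  unfold couplingDensity
  fun_prop

/-- The measure `∏ₖ |α_{c k}|⁻¹ dα dv`. -/
def rayMeasure [Fintype ι] (c : Fin n → ι) : Measure ((ι → ℝ) × (Fin n → ℝ)) :=
  (volume.withDensity (couplingDensity c)).prod volume

theorem rayMeasure_eq [Fintype ι] (c : Fin n → ι) :
    rayMeasure c = volume.withDensity fun a => couplingDensity c a.1 :=
  prod_withDensity_left (measurable_couplingDensity c)

end Rays

instance sigmaFinite_withDensity_rayDensity :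
    SigmaFinite ((volume : Measure (ℝ × ℝ)).withDensity fun a => rayDensity a.1) := by
  refine SigmaFinite.withDensity_of_ne_top ?_
  exact (Measure.quasiMeasurePreserving_fst.ae ae_real_ne_zero).mono fun a => rayDensity_ne_top

instance sigmaFinite_withDensity_rayDensity_mul :
    SigmaFinite ((volume : Measure (ℝ × (ℝ × ℝ))).withDensity
      fun a => rayDensity a.1 * rayDensity a.1) := by
  refine SigmaFinite.withDensity_of_ne_top ?_
  exact (Measure.quasiMeasurePreserving_fst.ae ae_real_ne_zero).mono fun a ha =>
    ENNReal.mul_ne_top (rayDensity_ne_top ha) (rayDensity_ne_top ha)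

/-- After regrouping, `rays` acts on each pair `(α_k, v_k)` separately as `rayPoint`, and both
measures are product measures. -/
theorem measurePreserving_rays_bar (n : ℕ) :
    MeasurePreserving (rays (barCoupling n)) (rayMeasure (barCoupling n)) (barKernel n) := by
  have hG := volume_measurePreserving_arrowProdEquivProdArrow ℝ ℝ (Fin n)
  set G := MeasurableEquiv.arrowProdEquivProdArrow ℝ ℝ (Fin n)
  have h1 : rayMeasure (barCoupling n) =
      (Measure.pi fun _ : Fin n => volume.withDensity fun a : ℝ × ℝ => rayDensity a.1).map G := by
    rw [rayMeasure_eq, ← hG.map_eq, map_withDensity_comp G.measurable (by fun_prop),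
      pi_withDensity _ _ (fun _ => by fun_prop)]
    rfl
  have h2 : barKernel n =
      (Measure.pi fun _ : Fin n => (volume : Measure (ℝ × ℝ)).withDensity diagDensity).map G := by
    rw [barKernel, ← hG.map_eq, map_withDensity_comp G.measurable,
      pi_withDensity _ _ (fun _ => measurable_diagDensity)]
    · rfl
    · exact Finset.measurable_prod _ fun k _ => measurable_ofReal_abs_inv (by fun_prop)
  have hm : Measurable (rays (barCoupling n)) := by unfold rays; fun_prop
  have hpi := measurePreserving_pi _ _ fun _ : Fin n => measurePreserving_rayPoint
  refine ⟨hm, ?_⟩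
  rw [h1, h2, Measure.map_map hm G.measurable, ← hpi.map_eq, Measure.map_map G.measurable
    hpi.measurable]
  rfl

/-- The kernel `∏ᵢ δ(sin (φ_i - ϕ_i)) / ∏ₖ ‖(x_k, u_k)‖`, with a factor `|x_last - u_last|⁻¹` in
place of `‖(x_last, u_last)‖⁻¹` for odd `n`. -/
def tildeKernel (n : ℕ) : Measure (Phase n) :=
  ((Measure.pi fun _ : Fin (n / 2) => pairKernel).prod
    (Measure.pi fun _ : Fin (n % 2) => volume.withDensity diagDensity)).map (phaseOf n)

theorem rays_raysOf (n : ℕ) (a : (Fin (n / 2) → ℝ × (ℝ × ℝ)) × (Fin (n % 2) → ℝ × ℝ)) :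
    rays (tildeCoupling n) (raysOf n a) =
      phaseOf n (fun i => rayPair (a.1 i), fun j => rayPoint (a.2 j).1 (a.2 j).2) := by
  have key : ∀ k, ((rays (tildeCoupling n) (raysOf n a)).1 k,
      (rays (tildeCoupling n) (raysOf n a)).2 k) =
      ((phaseOf n (fun i => rayPair (a.1 i), fun j => rayPoint (a.2 j).1 (a.2 j).2)).1 k,
      (phaseOf n (fun i => rayPair (a.1 i), fun j => rayPoint (a.2 j).1 (a.2 j).2)).2 k) := by
    intro k
    obtain ⟨s, rfl⟩ := (indexEquiv n).surjective k
    rcases s with (i | i) | j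
    · rw [phaseOf_fst]
      simp only [rays, tildeCoupling_indexEquiv_fst, raysOf_param, raysOf_fst]
      rfl
    · rw [phaseOf_snd]
      simp only [rays, tildeCoupling_indexEquiv_snd, raysOf_param, raysOf_snd]
      rfl
    · rw [phaseOf_last]
      simp only [rays, tildeCoupling_indexEquiv_last, raysOf_param_last, raysOf_last]
      rfl
  exact Prod.ext (funext fun k => (Prod.ext_iff.1 (key k)).1)
    (funext fun k => (Prod.ext_iff.1 (key k)).2)

/-- After regrouping by parameter, `rays` is a product of copies of `rayPair` and, for odd `n`, one
`rayPoint`. -/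
theorem measurePreserving_rays_tilde (n : ℕ) :
    MeasurePreserving (rays (tildeCoupling n)) (rayMeasure (tildeCoupling n)) (tildeKernel n) := by
  have hH := measurePreserving_raysOf n
  have hG := measurePreserving_phaseOf n
  have h1 : rayMeasure (tildeCoupling n) =
      ((Measure.pi fun _ : Fin (n / 2) => volume.withDensity
          fun a : ℝ × (ℝ × ℝ) => rayDensity a.1 * rayDensity a.1).prod
        (Measure.pi fun _ : Fin (n % 2) => volume.withDensity
          fun a : ℝ × ℝ => rayDensity a.1)).map (raysOf n) := by
    rw [rayMeasure_eq, ← hH.map_eq, map_withDensity_comp hH.measurable (by fun_prop),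
      pi_withDensity _ _ (fun _ => by fun_prop), pi_withDensity _ _ (fun _ => by fun_prop),
      prod_withDensity (by fun_prop) (by fun_prop)]
    congr 2
    funext a
    simp only [Function.comp_apply, couplingDensity]
    rw [prod_indexEquiv]
    simp only [tildeCoupling_indexEquiv_fst, tildeCoupling_indexEquiv_snd,
      tildeCoupling_indexEquiv_last, raysOf_param, raysOf_param_last]
  have hm : Measurable (rays (tildeCoupling n)) := by unfold rays; fun_prop
  have hpi := (measurePreserving_pi _ _ fun _ : Fin (n / 2) => measurePreserving_rayPair).prod
    (measurePreserving_pi _ _ fun _ : Fin (n % 2) => measurePreserving_rayPoint)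
  refine ⟨hm, ?_⟩
  rw [h1, tildeKernel, Measure.map_map hm hH.measurable, ← hpi.map_eq,
    Measure.map_map hG.measurable hpi.measurable]
  exact congrArg (fun T => Measure.map T _) (funext fun a => rays_raysOf n a)

/-- The measure `∏ᵢ δ(sin (φ_i - ϕ_i))`. -/
def tildeDelta (n : ℕ) : Measure (Phase n) :=
  ((Measure.pi fun _ : Fin (n / 2) => pairDelta).prod volume).map (phaseOf n)

instance : SigmaFinite (pairDelta.withDensity pairWeight) := by
  rw [pairDelta_withDensity]; infer_instance

/-- The product over `Fin (n % 2)` is empty for even `n` and has one factor for odd `n`, so one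
identity serves both parities. -/
theorem tildeDelta_withDensity (n : ℕ) :
    (tildeDelta n).withDensity (fun w => pairDensity n w *
      ∏ j : Fin (n % 2), (ENNReal.ofReal
        |w.1 (indexEquiv n (.inr j)) - w.2 (indexEquiv n (.inr j))|)⁻¹) = tildeKernel n := by
  have hG := measurePreserving_phaseOf n
  have hm1 : Measurable (pairDensity n) := by
    unfold pairDensity norm2
    exact Finset.measurable_prod _ fun i _ => (ENNReal.measurable_ofReal.comp (by fun_prop)).inv
  have hm2 : Measurable fun w : Phase n => ∏ j : Fin (n % 2), (ENNReal.ofReal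
        |w.1 (indexEquiv n (.inr j)) - w.2 (indexEquiv n (.inr j))|)⁻¹ :=
    Finset.measurable_prod _ fun j _ => measurable_ofReal_abs_inv (by fun_prop)
  rw [tildeDelta, map_withDensity_comp hG.measurable (by exact hm1.mul hm2), tildeKernel,
    pi_withDensity _ _ (fun _ => measurable_diagDensity), ← pairDelta_withDensity,
    pi_withDensity _ _ (fun _ => measurable_pairWeight),
    prod_withDensity (by fun_prop) (by fun_prop)]
  congr 2
  funext a
  simp only [Function.comp_apply, pairDensity, pairWeight, diagDensity]
  congr 1
  · refine Finset.prod_congr rfl fun i _ => ?_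
    have h1 := Prod.ext_iff.1 (phaseOf_fst a i)
    have h2 := Prod.ext_iff.1 (phaseOf_snd a i)
    rw [← h1.1, ← h1.2, ← h2.1, ← h2.2]
    rfl
  · refine Finset.prod_congr rfl fun j _ => ?_
    rw [← phaseOf_last a j]

/-! ### The limit defining `∏ᵢ δ(sin (φ_i - ϕ_i))` -/

/-- The two branches of the argument differ by multiples of `2π`, which the sine does not see. -/
theorem sin_angle_sub_angle (p q : ℝ × ℝ) :
    Real.sin (angle p.1 p.2 - angle q.1 q.2) =
      Real.sin (Complex.arg ⟨p.1, p.2⟩ - Complex.arg ⟨q.1, q.2⟩) := by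
  have h (x : ℝ) : ∃ m : ℤ, toIcoMod Real.two_pi_pos 0 x = x - m * (2 * Real.pi) :=
    ⟨toIcoDiv Real.two_pi_pos 0 x, by rw [toIcoMod, zsmul_eq_mul]⟩
  obtain ⟨a, ha⟩ := h (Complex.arg ⟨p.1, p.2⟩)
  obtain ⟨b, hb⟩ := h (Complex.arg ⟨q.1, q.2⟩)
  rw [angle, angle, ha, hb, show ∀ x y : ℝ, x - a * (2 * Real.pi) - (y - b * (2 * Real.pi)) =
    x - y - ((a - b : ℤ) : ℝ) * (2 * Real.pi) by intro x y; push_cast; ring,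
    Real.sin_sub_int_mul_two_pi]

theorem norm_mk_eq_sqrt_normSq (p : ℝ × ℝ) : ‖(⟨p.1, p.2⟩ : ℂ)‖ = √(normSq p) := by
  rw [Complex.norm_def, Complex.normSq_mk, normSq, sq, sq]

theorem sin_arg_sub_arg {p q : ℝ × ℝ} (hp : p ≠ 0) (hq : q ≠ 0) :
    Real.sin (Complex.arg ⟨p.1, p.2⟩ - Complex.arg ⟨q.1, q.2⟩) =
      (p.2 * q.1 - p.1 * q.2) / (√(normSq p) * √(normSq q)) := by
  have h (p : ℝ × ℝ) (hp : p ≠ 0) : (⟨p.1, p.2⟩ : ℂ) ≠ 0 := fun h =>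
    hp (Prod.ext (congrArg Complex.re h) (congrArg Complex.im h))
  have h1 := Real.sqrt_pos.2 (normSq_pos hp)
  have h2 := Real.sqrt_pos.2 (normSq_pos hq)
  rw [Real.sin_sub, Complex.sin_arg, Complex.sin_arg, Complex.cos_arg (h p hp),
    Complex.cos_arg (h q hq), norm_mk_eq_sqrt_normSq, norm_mk_eq_sqrt_normSq]
  field_simp

theorem normSq_rotPair_snd {ε : ℝ} {c : (ℝ × ℝ) × (ℝ × ℝ)} (h : (ε * c.2.2) ^ 2 ≤ 1) :
    normSq (rotPair ε c).2 = c.2.1 ^ 2 * normSq c.1 := by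
  have hs := Real.sq_sqrt (sub_nonneg.2 h)
  have hl := sq_abs c.2.1
  simp only [normSq, rotPair, Prod.fst_add, Prod.snd_add, Prod.smul_fst, Prod.smul_snd, smul_eq_mul]
  set r := √(1 - (ε * c.2.2) ^ 2)
  set s := ε * c.2.2
  calc _ = (c.2.1 ^ 2 * r ^ 2 + |c.2.1| ^ 2 * s ^ 2) * (c.1.1 ^ 2 + c.1.2 ^ 2) := by ring
    _ = _ := by rw [hl, hs]; ring

/-- A nonzero density encodes all nondegeneracy: `p ≠ 0`, `l ≠ 0` and `|ε τ| < 1`. The sine is then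
the cross product of the two vectors divided by their lengths. -/
theorem sin_angle_rotPair {ε : ℝ} {c : (ℝ × ℝ) × (ℝ × ℝ)} (h : rotDensity ε c ≠ 0) :
    Real.sin (angle (rotPair ε c).1.1 (rotPair ε c).1.2 -
      angle (rotPair ε c).2.1 (rotPair ε c).2.2) = ε * c.2.2 := by
  unfold rotDensity at h
  have hl : c.2.1 ≠ 0 := fun h0 => h (by simp [h0])
  have hN : normSq c.1 ≠ 0 := fun h0 => h (by simp [h0])
  have hr : √(1 - (ε * c.2.2) ^ 2) ≠ 0 := fun h0 => h (by simp [h0])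
  have hs : 0 < 1 - (ε * c.2.2) ^ 2 := by
    by_contra hs
    exact hr (Real.sqrt_eq_zero_of_nonpos (not_lt.1 hs))
  have hNpos : 0 < normSq c.1 := (normSq_nonneg _).lt_of_ne' hN
  have hNq := normSq_rotPair_snd (ε := ε) (c := c) (by linarith)
  have hz : normSq 0 = 0 := by simp [normSq]
  have hp : c.1 ≠ 0 := fun h0 => hN (by rw [h0, hz])
  have hq : (rotPair ε c).2 ≠ 0 := fun h0 => by
    rw [h0, hz] at hNq
    exact (mul_ne_zero (pow_ne_zero 2 hl) hN) hNq.symm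
  rw [sin_angle_sub_angle, sin_arg_sub_arg (by exact hp) hq, hNq, Real.sqrt_mul (sq_nonneg _),
    Real.sqrt_sq_eq_abs, mul_left_comm, show (rotPair ε c).1 = c.1 from rfl,
    Real.mul_self_sqrt hNpos.le, div_eq_iff (by positivity)]
  simp only [rotPair, Prod.fst_add, Prod.snd_add, Prod.smul_fst, Prod.smul_snd, smul_eq_mul, normSq]
  ring

/-- Replacing `q` by the proportional vector `l p` keeps its Euclidean length; the factor `2` pays
for passing between Euclidean and sup norms. This confines the supports to a region independent of
`ε`. -/
theorem norm_le_of_norm_rotPair_le {ε R : ℝ} {c : (ℝ × ℝ) × (ℝ × ℝ)}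
    (h : (ε * c.2.2) ^ 2 ≤ 1) (hR : ‖rotPair ε c‖ ≤ R) :
    propPair (c.1, c.2.1) ∈ Metric.closedBall (0 : (ℝ × ℝ) × (ℝ × ℝ)) (2 * R) := by
  have h1 : ‖c.1‖ ≤ R := (norm_fst_le (rotPair ε c)).trans hR
  have h2 : ‖(rotPair ε c).2‖ ≤ R := (norm_snd_le _).trans hR
  have hR0 : 0 ≤ R := (norm_nonneg _).trans h1
  have h3 : ‖c.1‖ ^ 2 ≤ normSq c.1 := by
    rcases max_choice ‖c.1.1‖ ‖c.1.2‖ with h | h <;>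
      rw [Prod.norm_def, h, Real.norm_eq_abs, sq_abs, normSq]
    · linarith [sq_nonneg c.1.2]
    · linarith [sq_nonneg c.1.1]
  have h4 : (|c.2.1| * ‖c.1‖) ^ 2 ≤ (2 * R) ^ 2 :=
    calc (|c.2.1| * ‖c.1‖) ^ 2 = c.2.1 ^ 2 * ‖c.1‖ ^ 2 := by rw [mul_pow, sq_abs]
      _ ≤ c.2.1 ^ 2 * normSq c.1 := by gcongr
      _ = normSq (rotPair ε c).2 := (normSq_rotPair_snd h).symm
      _ ≤ 2 * ‖(rotPair ε c).2‖ ^ 2 := normSq_le _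
      _ ≤ 2 * R ^ 2 := by gcongr
      _ ≤ (2 * R) ^ 2 := by nlinarith
  rw [mem_closedBall_zero_iff, propPair, Prod.norm_def, max_le_iff, norm_smul]
  exact ⟨by simp only; linarith, abs_le_of_sq_le_sq' h4 (by linarith) |>.2⟩

variable {n : ℕ}

theorem norm_le_of_norm_phaseOf_le {R : ℝ}
    {a : (Fin (n / 2) → (ℝ × ℝ) × (ℝ × ℝ)) × (Fin (n % 2) → ℝ × ℝ)} (h : ‖phaseOf n a‖ ≤ R) :
    (∀ i, ‖a.1 i‖ ≤ R) ∧ ∀ j, ‖a.2 j‖ ≤ R := by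
  have key (k : Fin n) : ‖((phaseOf n a).1 k, (phaseOf n a).2 k)‖ ≤ R :=
    max_le (((norm_le_pi_norm _ k).trans (norm_fst_le _)).trans h)
      (((norm_le_pi_norm _ k).trans (norm_snd_le _)).trans h)
  refine ⟨fun i => max_le ?_ ?_, fun j => ?_⟩
  · rw [← phaseOf_fst a i]; exact key _
  · rw [← phaseOf_snd a i]; exact key _
  · rw [← phaseOf_last a j]; exact key _

theorem continuous_phaseOf (n : ℕ) : Continuous (phaseOf n) := by
  have key (k : Fin n) : Continuous fun a => ((phaseOf n a).1 k, (phaseOf n a).2 k) := by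
    obtain ⟨s, rfl⟩ := (indexEquiv n).surjective k
    rcases s with (i | i) | j
    · simp_rw [phaseOf_fst]; fun_prop
    · simp_rw [phaseOf_snd]; fun_prop
    · simp_rw [phaseOf_last]; fun_prop
  exact (continuous_pi fun k => (key k).fst).prodMk (continuous_pi fun k => (key k).snd)

instance (n : ℕ) : IsFiniteMeasureOnCompacts (tildeDelta n) where
  lt_top_of_isCompact K hK := by
    obtain ⟨R, hR⟩ := hK.isBounded.subset_closedBall 0
    rw [tildeDelta, Measure.map_apply (measurePreserving_phaseOf n).measurable hK.measurableSet]
    refine (measure_mono (t := (Set.univ.pi fun _ => Metric.closedBall 0 R) ×ˢ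
      (Set.univ.pi fun _ => Metric.closedBall 0 R)) fun a ha => ?_).trans_lt ?_
    · have h := norm_le_of_norm_phaseOf_le (mem_closedBall_zero_iff.1 (hR ha))
      exact ⟨fun i _ => mem_closedBall_zero_iff.2 (h.1 i),
        fun j _ => mem_closedBall_zero_iff.2 (h.2 j)⟩
    · rw [Measure.prod_prod, Measure.pi_pi, volume_pi, Measure.pi_pi]
      exact ENNReal.mul_lt_top (ENNReal.prod_lt_top fun i _ => pairDelta_closedBall_lt_top R)
        (ENNReal.prod_lt_top fun j _ => (isCompact_closedBall (0 : ℝ × ℝ) R).measure_lt_top)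

/-- Used with `rotPair ε` and Lebesgue measure for the approximations, and with `rotPair 0` and
`pairDelta` for the limit. -/
theorem integral_map_phaseOf {ν : Measure ((ℝ × ℝ) × (ℝ × ℝ))} [SigmaFinite ν]
    {d : (ℝ × ℝ) × (ℝ × ℝ) → ℝ} (hd : Measurable d) (hd0 : ∀ c, 0 ≤ d c)
    {T : (ℝ × ℝ) × (ℝ × ℝ) → (ℝ × ℝ) × (ℝ × ℝ)}
    (hT : MeasurePreserving T (volume.withDensity fun c => ENNReal.ofReal (d c)) ν)
    {g : Phase n → ℝ} (hg : Measurable g) :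
    ∫ w, g w ∂(((Measure.pi fun _ : Fin (n / 2) => ν).prod volume).map (phaseOf n)) =
      ∫ a : (Fin (n / 2) → (ℝ × ℝ) × (ℝ × ℝ)) × (Fin (n % 2) → ℝ × ℝ),
        (∏ i, d (a.1 i)) * g (phaseOf n (fun i => T (a.1 i), a.2)) := by
  have hpi := (measurePreserving_pi _ _ fun _ : Fin (n / 2) => hT).prod
    (MeasurePreserving.id (volume : Measure (Fin (n % 2) → ℝ × ℝ)))
  have hG := (measurePreserving_phaseOf n).measurable
  rw [← hpi.map_eq, Measure.map_map hG hpi.measurable,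
    integral_map (hG.comp hpi.measurable).aemeasurable hg.aestronglyMeasurable,
    pi_withDensity _ _ (fun _ => by fun_prop), prod_withDensity_left (by fun_prop),
    integral_withDensity_eq_integral_toReal_smul (by fun_prop)
      (ae_of_all _ fun a => ENNReal.prod_lt_top fun i _ => ENNReal.ofReal_lt_top)]
  refine integral_congr_ae (ae_of_all _ fun a => ?_)
  simp only [smul_eq_mul, ENNReal.toReal_prod, ENNReal.toReal_ofReal (hd0 _)]
  rfl

theorem sinDiff_phaseOf (a : (Fin (n / 2) → (ℝ × ℝ) × (ℝ × ℝ)) × (Fin (n % 2) → ℝ × ℝ))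
    (i : Fin (n / 2)) :
    sinDiff n (phaseOf n a) i =
      Real.sin (angle (a.1 i).1.1 (a.1 i).1.2 - angle (a.1 i).2.1 (a.1 i).2.2) := by
  rw [← phaseOf_fst a i, ← phaseOf_snd a i]
  rfl

theorem measurable_sinDiff (i : Fin (n / 2)) : Measurable fun w => sinDiff n w i := by
  have h (k : Fin n) : Measurable fun w : Phase n => Complex.arg ⟨w.1 k, w.2 k⟩ := by
    refine Complex.measurable_arg.comp ?_
    exact Complex.measurableEquivRealProd.symm.measurable.comp
      (f := fun w : Phase n => (w.1 k, w.2 k)) (by fun_prop)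
  have h' := Real.measurable_sin.comp ((h (fstIdx i)).sub (h (sndIdx i)))
  convert h' using 2 with w
  exact sin_angle_sub_angle (w.1 (fstIdx i), w.2 (fstIdx i)) (w.1 (sndIdx i), w.2 (sndIdx i))

/-- An integrable majorant of `ρ(τ)` times the Jacobian of `rotPair ε`. -/
def rotBound (C M R : ℝ) (c : (ℝ × ℝ) × (ℝ × ℝ)) : ℝ :=
  (propPair ⁻¹' Metric.closedBall 0 (2 * R)).indicator propDensity (c.1, c.2.1) *
    (Set.Icc (-M) M).indicator (fun _ => 2 * C) c.2.2

theorem integrable_rotBound (C M R : ℝ) : Integrable (rotBound C M R) := by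
  have hs : MeasurableSet (propPair ⁻¹' Metric.closedBall 0 (2 * R)) :=
    measurable_propPair Metric.isClosed_closedBall.measurableSet
  -- The integral of this factor is the `pairDelta` measure of the ball of radius `2 R`.
  have h1 : Integrable ((propPair ⁻¹' Metric.closedBall 0 (2 * R)).indicator propDensity) := by
    refine ⟨(continuous_propDensity.measurable.indicator hs).aestronglyMeasurable, ?_⟩
    have h := pairDelta_closedBall_lt_top (2 * R)
    rw [pairDelta, Measure.map_apply measurable_propPair Metric.isClosed_closedBall.measurableSet,
      withDensity_apply _ hs, ← lintegral_indicator hs] at h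
    rw [hasFiniteIntegral_iff_enorm]
    refine lt_of_eq_of_lt (lintegral_congr fun b => ?_) h
    by_cases hb : b ∈ propPair ⁻¹' Metric.closedBall 0 (2 * R)
    · simp only [Set.indicator_of_mem hb]
      exact Real.enorm_of_nonneg (propDensity_nonneg b)
    · simp only [Set.indicator_of_notMem hb, enorm_zero]
  have h2 : Integrable ((Set.Icc (-M) M).indicator fun _ => 2 * C) :=
    (integrable_indicator_iff measurableSet_Icc).2 (integrableOn_const (by simp))
  have hassoc : MeasurePreserving
      (MeasurableEquiv.prodAssoc : ((ℝ × ℝ) × ℝ) × ℝ ≃ᵐ (ℝ × ℝ) × (ℝ × ℝ)) :=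
    ⟨MeasurableEquiv.prodAssoc.measurable, Measure.prodAssoc_prod⟩
  rw [← hassoc.integrable_comp_emb MeasurableEquiv.prodAssoc.measurableEmbedding]
  exact h1.mul_prod h2

theorem rotBound_nonneg {C : ℝ} (hC : 0 ≤ C) (M R : ℝ) (c : (ℝ × ℝ) × (ℝ × ℝ)) :
    0 ≤ rotBound C M R c :=
  mul_nonneg (Set.indicator_nonneg (fun _ _ => propDensity_nonneg _) _)
    (Set.indicator_nonneg (fun _ _ => by positivity) _)

theorem mul_rotDensity_le_rotBound {ρ : ℝ → ℝ} {C M R ε : ℝ} (hρC : ∀ t, ρ t ≤ C)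
    (hρM : ∀ t, M < |t| → ρ t = 0) (hρ0 : ∀ t, 0 ≤ ρ t) (hε : 0 < ε) (hεM : ε * (2 * M) ≤ 1)
    {c : (ℝ × ℝ) × (ℝ × ℝ)} (hc : ‖rotPair ε c‖ ≤ R) :
    ρ c.2.2 * rotDensity ε c ≤ rotBound C M R c := by
  have hC : 0 ≤ C := (hρ0 0).trans (hρC 0)
  rcases lt_or_ge M |c.2.2| with hτ | hτ
  · rw [hρM _ hτ, zero_mul]
    exact rotBound_nonneg hC M R c
  -- Keeping `|ε τ|` at most `1/2` on the support of `ρ` bounds the square root below by `1/2`; this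
  -- is the factor `2` in `rotBound`.
  · have h1 : |ε * c.2.2| ≤ 1 / 2 := by
      rw [abs_mul, abs_of_pos hε]
      nlinarith
    have h2 : (ε * c.2.2) ^ 2 ≤ 1 / 4 := by
      rw [← sq_abs]
      nlinarith [abs_nonneg (ε * c.2.2)]
    have h3 : 1 / 2 ≤ √(1 - (ε * c.2.2) ^ 2) := Real.le_sqrt_of_sq_le (by linarith)
    have hmem := norm_le_of_norm_rotPair_le (by linarith) hc
    rw [rotBound, Set.indicator_of_mem (by exact hmem), Set.indicator_of_mem (by
      rw [Set.mem_Icc, ← abs_le]; exact hτ)]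
    have h4 : rotDensity ε c ≤ propDensity (c.1, c.2.1) * 2 := by
      rw [rotDensity, div_le_iff₀ (by linarith)]
      have := propDensity_nonneg (c.1, c.2.1)
      simp only [propDensity] at this ⊢
      nlinarith
    have := rotDensity_nonneg ε c
    calc ρ c.2.2 * rotDensity ε c ≤ C * (propDensity (c.1, c.2.1) * 2) :=
          mul_le_mul (hρC _) h4 this hC
      _ = _ := by ring

theorem tendsto_rotDensity (c : (ℝ × ℝ) × (ℝ × ℝ)) :
    Tendsto (fun ε => rotDensity ε c) (𝓝 0) (𝓝 (rotDensity 0 c)) := by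
  have : ContinuousAt (fun ε : ℝ => |c.2.1| * normSq c.1 / √(1 - (ε * c.2.2) ^ 2)) 0 :=
    ContinuousAt.div (by fun_prop) (by fun_prop) (by simp)
  exact this

/-- In the coordinates of `rotPair ε` the mollified sine becomes `ρ(τ)`, with no power of `ε` left.
Only the Jacobian and the argument of `ψ` depend on `ε`, both continuously at `0`, and `rotBound`
supplies the domination. -/
theorem isDelta_tildeDelta (n : ℕ) : IsDelta (sinDiff n) (tildeDelta n) := by
  refine ⟨inferInstance, fun ρ hρ ψ hψ hψc => ?_⟩
  have hρm : Measurable ρ := hρ.smooth.continuous.measurable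
  have hψm : Measurable ψ := hψ.measurable
  rw [tildeDelta, integral_map_phaseOf (by fun_prop)
    (fun c => mul_nonneg (hρ.nonneg _) (rotDensity_nonneg _ _)) (measurePreserving_rotPair_zero hρ)
    hψm]
  have hε (ε : ℝ) (hε : 0 < ε) : ∫ w, (∏ i, ε⁻¹ * ρ (sinDiff n w i / ε)) * ψ w =
      ∫ a : (Fin (n / 2) → (ℝ × ℝ) × (ℝ × ℝ)) × (Fin (n % 2) → ℝ × ℝ),
        (∏ i, ρ (a.1 i).2.2 * rotDensity ε (a.1 i)) *
          ψ (phaseOf n (fun i => rotPair ε (a.1 i), a.2)) := by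
    have hm : Measurable fun w => (∏ i, ε⁻¹ * ρ (sinDiff n w i / ε)) * ψ w :=
      (Finset.measurable_prod _ fun i _ =>
        (hρm.comp ((measurable_sinDiff i).div_const ε)).const_mul _).mul hψm
    have h := integral_map_phaseOf (by fun_prop)
      (fun c => mul_nonneg hε.le (rotDensity_nonneg ε c)) (measurePreserving_rotPair hε) hm
    rw [show ((Measure.pi fun _ : Fin (n / 2) => volume).prod volume).map (phaseOf n) = volume from
      (measurePreserving_phaseOf n).map_eq] at h
    rw [h]
    refine integral_congr_ae (ae_of_all _ fun a => ?_)
    simp only [← mul_assoc, ← Finset.prod_mul_distrib, sinDiff_phaseOf]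
    congr 1
    refine Finset.prod_congr rfl fun i _ => ?_
    -- Where the Jacobian vanishes the sine need not equal `ε τ`, but both factors are `0`.
    rcases eq_or_ne (rotDensity ε (a.1 i)) 0 with h0 | h0
    · simp [h0]
    · rw [sin_angle_rotPair h0, mul_div_cancel_left₀ _ hε.ne']
      field_simp
  obtain ⟨Cψ, hCψ⟩ := hψc.exists_bound_of_continuous hψ
  obtain ⟨C, hC⟩ := hρ.compact.exists_bound_of_continuous hρ.smooth.continuous
  obtain ⟨R, hR⟩ := hψc.isCompact.isBounded.subset_closedBall 0
  obtain ⟨M, hM0, hM⟩ := hρ.compact.isCompact.isBounded.subset_closedBall_lt 0 0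
  have hρC (t : ℝ) : ρ t ≤ C := (le_abs_self _).trans (hC t)
  have hC0 : 0 ≤ C := (hρ.nonneg 0).trans (hρC 0)
  have hCψ0 : 0 ≤ Cψ := (norm_nonneg _).trans (hCψ 0)
  have hρM (t : ℝ) (ht : M < |t|) : ρ t = 0 := by
    by_contra h
    have := hM (subset_tsupport ρ h)
    rw [mem_closedBall_zero_iff, Real.norm_eq_abs] at this
    linarith
  have hb0 (a : Fin (n % 2) → ℝ × ℝ) :
      0 ≤ ∏ j, (Metric.closedBall (0 : ℝ × ℝ) R).indicator (fun _ => (1 : ℝ)) (a j) :=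
    Finset.prod_nonneg fun j _ => Set.indicator_nonneg (fun _ _ => zero_le_one) _
  refine Tendsto.congr' (f₁ := fun ε => _) (eventually_nhdsWithin_of_forall fun ε h =>
    (hε ε h).symm) ?_
  refine tendsto_integral_filter_of_dominated_convergence
    (fun a => Cψ * ((∏ i, rotBound C M R (a.1 i)) *
      ∏ j, (Metric.closedBall (0 : ℝ × ℝ) R).indicator (fun _ => (1 : ℝ)) (a.2 j)))
    (Eventually.of_forall fun ε => ?_) ?_ ?_ (ae_of_all _ fun a => ?_)
  · have := (measurePreserving_phaseOf n).measurable
    exact Measurable.aestronglyMeasurable (by fun_prop)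
  · have h1 : ∀ᶠ ε : ℝ in 𝓝[>] 0, 0 < ε := eventually_nhdsWithin_of_forall fun ε h => h
    have h2 : ∀ᶠ ε : ℝ in 𝓝[>] 0, ε < (2 * M)⁻¹ :=
      nhdsWithin_le_nhds (eventually_lt_nhds (by positivity))
    filter_upwards [h1, h2] with ε hε0 hεM
    refine ae_of_all _ fun a => ?_
    have hεM' : ε * (2 * M) ≤ 1 := by
      calc ε * (2 * M) ≤ (2 * M)⁻¹ * (2 * M) := by gcongr
        _ = 1 := inv_mul_cancel₀ (by positivity)
    have hprod0 : 0 ≤ ∏ i, ρ (a.1 i).2.2 * rotDensity ε (a.1 i) :=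
      Finset.prod_nonneg fun i _ => mul_nonneg (hρ.nonneg _) (rotDensity_nonneg _ _)
    by_cases hψ0 : ψ (phaseOf n (fun i => rotPair ε (a.1 i), a.2)) = 0
    · rw [hψ0, mul_zero, norm_zero]
      exact mul_nonneg hCψ0 (mul_nonneg (Finset.prod_nonneg fun i _ => rotBound_nonneg hC0 M R _)
        (hb0 _))
    · have hmem := mem_closedBall_zero_iff.1 (hR (subset_tsupport ψ hψ0))
      obtain ⟨ha1, ha2⟩ := norm_le_of_norm_phaseOf_le hmem
      have hone : ∏ j, (Metric.closedBall (0 : ℝ × ℝ) R).indicator (fun _ => (1 : ℝ)) (a.2 j)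
          = 1 := Finset.prod_eq_one fun j _ =>
        Set.indicator_of_mem (mem_closedBall_zero_iff.2 (ha2 j)) _
      rw [hone, mul_one, norm_mul, mul_comm, Real.norm_of_nonneg hprod0]
      refine mul_le_mul (hCψ _) ?_ hprod0 hCψ0
      exact Finset.prod_le_prod
        (fun i _ => mul_nonneg (hρ.nonneg _) (rotDensity_nonneg _ _))
        fun i _ => mul_rotDensity_le_rotBound hρC hρM hρ.nonneg hε0 hεM' (ha1 i)
  · refine Integrable.const_mul (Integrable.mul_prod
      (f := fun a : Fin (n / 2) → (ℝ × ℝ) × (ℝ × ℝ) => ∏ i, rotBound C M R (a i))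
      (g := fun a : Fin (n % 2) → ℝ × ℝ =>
        ∏ j, (Metric.closedBall (0 : ℝ × ℝ) R).indicator (fun _ => (1 : ℝ)) (a j))
      (Integrable.fintype_prod fun _ => integrable_rotBound C M R)
      (Integrable.fintype_prod fun _ => ?_)) _
    exact (integrable_indicator_iff Metric.isClosed_closedBall.measurableSet).2
      (integrableOn_const (isCompact_closedBall (0 : ℝ × ℝ) R).measure_lt_top.ne)
  · refine Tendsto.mono_left ?_ nhdsWithin_le_nhds
    refine Tendsto.mul (tendsto_finsetProd _ fun i _ => (tendsto_rotDensity _).const_mul _) ?_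
    have hcont : Continuous fun ε : ℝ => ψ (phaseOf n (fun i => rotPair ε (a.1 i), a.2)) := by
      refine hψ.comp ((continuous_phaseOf n).comp (Continuous.prodMk (continuous_pi fun i => ?_)
        continuous_const))
      exact continuous_rotPair.comp (Continuous.prodMk_left (a.1 i))
    exact hcont.tendsto 0

/-! ### Normal operators as integrals over rays -/

section Normal

variable {n : ℕ} {ι : Type}

@[fun_prop]
theorem measurable_rays (c : Fin n → ι) : Measurable (rays c) := by
  unfold rays; fun_prop

/-- At `u = z.2` the ray through the focal point of `z` is at `z` itself. This identity turns the
normal operator into a convolution. -/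
theorem ray_focal (c : Fin n → ι) {α : ι → ℝ} (hα : ∀ i, α i ≠ 0) (z : Phase n) (u : Fin n → ℝ) :
    ray c α (focal c α z) u = z - rays c (α, z.2 - u) := by
  refine Prod.ext (funext fun k => ?_) (funext fun k => ?_)
  · have := hα (c k)
    simp only [ray, focal, rays, Prod.fst_sub, Pi.sub_apply]
    field_simp
    ring
  · simp [ray, rays]

theorem couplingDensity_eq_ofReal (c : Fin n → ι) {α : ι → ℝ} (hα : ∀ i, α i ≠ 0) :
    couplingDensity c α = ENNReal.ofReal (∏ k, |α (c k)|)⁻¹ := by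
  rw [← Finset.prod_inv_distrib, ENNReal.ofReal_prod_of_nonneg fun _ _ => by positivity]
  exact Finset.prod_congr rfl fun k _ => rayDensity_eq_ofReal (hα _)

theorem etransform_focal (c : Fin n → ι) {α : ι → ℝ} (hα : ∀ i, α i ≠ 0) (g : Phase n → ℝ≥0∞)
    (z : Phase n) : etransform c g α (focal c α z) =
      couplingDensity c α * ∫⁻ v, g (z - rays c (α, v)) := by
  have hpos : 0 < ∏ k, |α (c k)| := Finset.prod_pos fun k _ => abs_pos.2 (hα _)
  rw [etransform, couplingDensity_eq_ofReal c hα, ← ENNReal.ofReal_prod_of_nonneg fun _ _ =>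
    abs_nonneg _, ENNReal.ofReal_inv_of_pos hpos]
  simp_rw [ray_focal c hα]
  rw [lintegral_sub_left_eq_self (fun v => g (z - rays c (α, v))) z.2]

theorem transform_focal (c : Fin n → ι) {α : ι → ℝ} (hα : ∀ i, α i ≠ 0) (f : Phase n → ℂ)
    (z : Phase n) : transform c f α (focal c α z) =
      (couplingDensity c α).toReal • ∫ v, f (z - rays c (α, v)) := by
  rw [transform, couplingDensity_eq_ofReal c hα, ENNReal.toReal_ofReal
    (inv_nonneg.2 (Finset.prod_nonneg fun _ _ => abs_nonneg _))]
  simp_rw [ray_focal c hα]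
  rw [integral_sub_left_eq_self (fun v => f (z - rays c (α, v))) volume z.2]

variable [Fintype ι]

theorem ae_forall_ne_zero : ∀ᵐ α : ι → ℝ, ∀ i, α i ≠ 0 :=
  ae_all_iff.2 fun i =>
    (Measure.quasiMeasurePreserving_eval (fun _ : ι => (volume : Measure ℝ)) i).ae ae_real_ne_zero

theorem edual_etransform {c : Fin n → ι} {K : Measure (Phase n)}
    (hK : MeasurePreserving (rays c) (rayMeasure c) K) {g : Phase n → ℝ≥0∞} (hg : Measurable g)
    (z : Phase n) : edual c (etransform c g) z = econv K g z := by
  have hm : Measurable fun a => g (z - rays c a) := by fun_prop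
  rw [econv, ← hK.lintegral_comp (by fun_prop), rayMeasure, lintegral_prod _ hm.aemeasurable,
    lintegral_withDensity_eq_lintegral_mul _ (measurable_couplingDensity c)
      hm.lintegral_prod_right', edual]
  exact lintegral_congr_ae (ae_forall_ne_zero.mono fun α hα => etransform_focal c hα g z)

/-- Transfers a truncation of the parameters to a truncation of the kernel; almost everywhere
agreement suffices, which leaves aside vanishing parameters or variables. -/
theorem measurePreserving_rays_restrict {c : Fin n → ι} {K : Measure (Phase n)}
    (hK : MeasurePreserving (rays c) (rayMeasure c) K) {S : Set (ι → ℝ)} (hS : MeasurableSet S)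
    {T : Set (Phase n)} (hT : MeasurableSet T)
    (hST : ∀ᵐ a ∂(rayMeasure c), rays c a ∈ T ↔ a.1 ∈ S) :
    MeasurePreserving (rays c) (((volume.restrict S).withDensity (couplingDensity c)).prod volume)
      (K.restrict T) := by
  have h := hK.restrict_preimage hT
  rwa [Measure.restrict_congr_set (t := S ×ˢ Set.univ) (eventuallyEq_set.2 (hST.mono fun a ha => by
      simpa using ha)), rayMeasure, ← Measure.prod_restrict, Measure.restrict_univ,
    restrict_withDensity hS] at h

/-- Fubini on the ray space, whose inner integrals are the values of the transform by
`transform_focal`. -/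
theorem integrable_transform_and_integral_eq {c : Fin n → ι} {S : Set (ι → ℝ)} {K : Measure (Phase n)}
    (hK : MeasurePreserving (rays c)
      (((volume.restrict S).withDensity (couplingDensity c)).prod volume) K)
    {f : Phase n → ℂ} {z : Phase n} (hf : Integrable (fun w => f (z - w)) K) :
    IntegrableOn (fun α => transform c f α (focal c α z)) S ∧
      ∫ α in S, transform c f α (focal c α z) = conv K f z := by
  have hint := (hK.integrable_comp hf.aestronglyMeasurable).2 hf
  have hfin : ∀ᵐ α ∂(volume.restrict S), couplingDensity c α < ⊤ :=
    ae_restrict_of_ae (ae_forall_ne_zero.mono fun α hα => by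
      rw [couplingDensity_eq_ofReal c hα]; exact ENNReal.ofReal_lt_top)
  have hcongr : (fun α => transform c f α (focal c α z)) =ᵐ[volume.restrict S]
      fun α => (couplingDensity c α).toReal • ∫ v, f (z - rays c (α, v)) :=
    ae_restrict_of_ae (ae_forall_ne_zero.mono fun α hα => transform_focal c hα f z)
  constructor
  · rw [IntegrableOn, integrable_congr hcongr]
    exact (integrable_withDensity_iff_integrable_smul' (measurable_couplingDensity c) hfin).1
      hint.integral_prod_left
  · rw [integral_congr_ae hcongr, ← integral_withDensity_eq_integral_toReal_smul
      (measurable_couplingDensity c) hfin, conv, ← hK.map_eq,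
      integral_map hK.aemeasurable (hK.map_eq ▸ hf.aestronglyMeasurable)]
    exact (integral_prod _ hint).symm

/-- The parameters bounded by `A` at the indices `κ j`. -/
def paramBox {J : Type} (c : Fin n → ι) (κ : J → Fin n) (A : ℝ) : Set (ι → ℝ) :=
  {α | ∀ j, |α (c (κ j))| ≤ A}

/-- The points with `|u_k| ≤ A |x_k - u_k|` at the indices `k = κ j`. -/
def coneBox {J : Type} (κ : J → Fin n) (A : ℝ) : Set (Phase n) :=
  {w | ∀ j, |w.2 (κ j)| ≤ A * |w.1 (κ j) - w.2 (κ j)|}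

variable {J : Type}

theorem measurableSet_paramBox [Countable J] (c : Fin n → ι) (κ : J → Fin n) (A : ℝ) :
    MeasurableSet (paramBox c κ A) := by
  rw [paramBox, Set.ofPred_forall]
  exact MeasurableSet.iInter fun j =>
    (isClosed_le (by fun_prop) (by fun_prop)).measurableSet

theorem measurableSet_coneBox [Countable J] (κ : J → Fin n) (A : ℝ) : MeasurableSet (coneBox κ A) := by
  rw [coneBox, Set.ofPred_forall]
  exact MeasurableSet.iInter fun j =>
    (isClosed_le (by fun_prop) (by fun_prop)).measurableSet

theorem ae_rays_mem_coneBox (c : Fin n → ι) (κ : J → Fin n) (A : ℝ) :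
    ∀ᵐ a ∂(rayMeasure c), rays c a ∈ coneBox κ A ↔ a.1 ∈ paramBox c κ A := by
  rw [rayMeasure_eq]
  refine (withDensity_absolutelyContinuous _ _).ae_le ?_
  have h1 : ∀ᵐ a : (ι → ℝ) × (Fin n → ℝ), ∀ i, a.1 i ≠ 0 :=
    Measure.quasiMeasurePreserving_fst.ae ae_forall_ne_zero
  have h2 : ∀ᵐ a : (ι → ℝ) × (Fin n → ℝ), ∀ i, a.2 i ≠ 0 :=
    Measure.quasiMeasurePreserving_snd.ae ae_forall_ne_zero
  filter_upwards [h1, h2] with a ha1 ha2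
  refine forall_congr' fun j => ?_
  have h3 := abs_pos.2 (ha1 (c (κ j)))
  have h4 := abs_pos.2 (ha2 (κ j))
  have h5 : (1 - 1 / a.1 (c (κ j))) * a.2 (κ j) - a.2 (κ j) = -(a.2 (κ j) / a.1 (c (κ j))) := by
    ring
  simp only [rays, h5, abs_neg, abs_div]
  rw [← mul_div_assoc, le_div_iff₀ h3, mul_comm, mul_le_mul_iff_left₀ h4]

end Normal

/-! ### Decay of Schwartz functions and absolute convergence -/

/-- The product weight is dominated by `(1 + ‖w‖)^(2n)`, and `1 + ‖w‖ ≤ (1 + ‖z‖)(1 + ‖z - w‖)`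
handles the translation. A product bound is needed so that the integral over `v` factors. -/
theorem exists_norm_sub_le_prod {n : ℕ} (f : SchwartzMap (Phase n) ℂ) (z : Phase n) :
    ∃ C, 0 ≤ C ∧ ∀ w, ‖f (z - w)‖ ≤ C * ∏ k, (1 + w.1 k ^ 2 + w.2 k ^ 2)⁻¹ := by
  set B := 2 ^ (2 * n) * (Finset.Iic (2 * n, 0)).sup
    (fun m => SchwartzMap.seminorm ℝ (E := Phase n) (F := ℂ) m.1 m.2) f with hB
  have hdecay (y : Phase n) : (1 + ‖y‖) ^ (2 * n) * ‖f y‖ ≤ B := by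
    have h := SchwartzMap.one_add_le_sup_seminorm_apply (𝕜 := ℝ) (m := (2 * n, 0)) (k := 2 * n)
      (n := 0) le_rfl le_rfl f y
    rwa [norm_iteratedFDeriv_zero] at h
  have hB0 : 0 ≤ B := le_trans (by positivity) (hdecay 0)
  refine ⟨2 ^ n * (1 + ‖z‖) ^ (2 * n) * B, by positivity, fun w => ?_⟩
  have hprod : ∏ k, (1 + w.1 k ^ 2 + w.2 k ^ 2) ≤ 2 ^ n * (1 + ‖w‖) ^ (2 * n) := by
    calc ∏ k, (1 + w.1 k ^ 2 + w.2 k ^ 2) ≤ ∏ _k : Fin n, 2 * (1 + ‖w‖) ^ 2 := by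
          refine Finset.prod_le_prod (fun k _ => by positivity) fun k _ => ?_
          have h1 : |w.1 k| ≤ ‖w‖ := (norm_le_pi_norm w.1 k).trans (norm_fst_le w)
          have h2 : |w.2 k| ≤ ‖w‖ := (norm_le_pi_norm w.2 k).trans (norm_snd_le w)
          rw [← sq_abs (w.1 k), ← sq_abs (w.2 k)]
          nlinarith [abs_nonneg (w.1 k), abs_nonneg (w.2 k)]
      _ = _ := by rw [Finset.prod_const, Finset.card_univ, Fintype.card_fin, mul_pow, ← pow_mul]
  have htri : 1 + ‖w‖ ≤ (1 + ‖z‖) * (1 + ‖z - w‖) := by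
    have : ‖w‖ ≤ ‖z‖ + ‖z - w‖ := by
      calc ‖w‖ = ‖z - (z - w)‖ := by rw [sub_sub_cancel]
        _ ≤ _ := norm_sub_le _ _
    nlinarith [mul_nonneg (norm_nonneg z) (norm_nonneg (z - w))]
  have hpos : 0 < ∏ k, (1 + w.1 k ^ 2 + w.2 k ^ 2) := Finset.prod_pos fun k _ => by positivity
  rw [Finset.prod_inv_distrib, ← div_eq_mul_inv, le_div_iff₀ hpos]
  calc ‖f (z - w)‖ * ∏ k, (1 + w.1 k ^ 2 + w.2 k ^ 2)
      ≤ ‖f (z - w)‖ * (2 ^ n * ((1 + ‖z‖) * (1 + ‖z - w‖)) ^ (2 * n)) := by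
        gcongr
        exact hprod.trans (by gcongr)
    _ = 2 ^ n * (1 + ‖z‖) ^ (2 * n) * ((1 + ‖z - w‖) ^ (2 * n) * ‖f (z - w)‖) := by
        rw [mul_pow]; ring
    _ ≤ _ := by
        gcongr
        exact hdecay _

theorem integrable_comp_ray {n : ℕ} {ι : Type} (f : SchwartzMap (Phase n) ℂ) (c : Fin n → ι)
    (α : ι → ℝ) (xbar : Fin n → ℝ) : Integrable fun u => f (ray c α xbar u) := by
  obtain ⟨C, hC0, hC⟩ := exists_norm_sub_le_prod f 0
  have hcont : Continuous fun u => f (ray c α xbar u) := by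
    refine f.continuous.comp ?_
    unfold ray
    exact Continuous.prodMk (continuous_pi fun k => by
      exact continuous_const.add (continuous_const.mul (continuous_apply k))) continuous_id
  refine Integrable.mono' (g := fun u : Fin n → ℝ => C * ∏ k, (1 + u k ^ 2)⁻¹)
    ((Integrable.fintype_prod fun _ => integrable_inv_one_add_sq).const_mul C)
    hcont.aestronglyMeasurable (ae_of_all _ fun u => ?_)
  have h := hC (-(ray c α xbar u))
  rw [zero_sub, neg_neg] at h
  refine h.trans ?_
  refine mul_le_mul_of_nonneg_left (Finset.prod_le_prod (fun k _ => by positivity) fun k _ => ?_) hC0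
  refine inv_anti₀ (by positivity) ?_
  simp only [ray, Prod.fst_neg, Prod.snd_neg, Pi.neg_apply, neg_sq]
  linarith [sq_nonneg (1 / α (c k) * xbar k + (1 - 1 / α (c k)) * u k)]

theorem lintegral_inv_one_add_sq_mul {b : ℝ} (hb : 0 < b) :
    ∫⁻ v : ℝ, ENNReal.ofReal (1 + (b * v) ^ 2)⁻¹ = ENNReal.ofReal (Real.pi / b) := by
  have h : ∫⁻ v : ℝ, ENNReal.ofReal (1 + v ^ 2)⁻¹ = ENNReal.ofReal Real.pi := by
    rw [← ofReal_integral_eq_lintegral_ofReal integrable_inv_one_add_sq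
      (ae_of_all _ fun _ => by positivity), integral_univ_inv_one_add_sq]
  rw [lintegral_affine hb.ne' 0, lintegral_const_mul' _ _ (by simp), abs_of_pos hb] at h
  simp only [add_zero] at h
  rw [ENNReal.ofReal_div_of_pos hb, ENNReal.eq_div_iff (by simpa using hb) (by simp), h]

/-- With `b² = (1 - 1/α)² + 1` the left side is `π / (|α| b)`, and `(|α| b)² = (α - 1)² + α²` has no
zero. The singularity at `α = 0` disappears and decay of order `1/|α|` remains. -/
theorem rayDensity_mul_lintegral_le {α : ℝ} (hα : α ≠ 0) :
    rayDensity α * ∫⁻ v : ℝ, ENNReal.ofReal (1 + ((1 - 1 / α) * v) ^ 2 + v ^ 2)⁻¹ ≤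
      ENNReal.ofReal (2 * Real.pi * (√(1 + α ^ 2))⁻¹) := by
  set b := √((1 - 1 / α) ^ 2 + 1) with hb
  have hb2 : b ^ 2 = (1 - 1 / α) ^ 2 + 1 := Real.sq_sqrt (by positivity)
  have hb0 : 0 < b := Real.sqrt_pos.2 (by positivity)
  have h1 (v : ℝ) : 1 + ((1 - 1 / α) * v) ^ 2 + v ^ 2 = 1 + (b * v) ^ 2 := by
    rw [mul_pow b, hb2]; ring
  simp_rw [h1]
  rw [lintegral_inv_one_add_sq_mul hb0, rayDensity_eq_ofReal hα,
    ← ENNReal.ofReal_mul (by positivity)]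
  refine ENNReal.ofReal_le_ofReal ?_
  have h2 : √(1 + α ^ 2) ≤ 2 * (|α| * b) := by
    refine Real.sqrt_le_iff.2 ⟨by positivity, ?_⟩
    rw [mul_pow, mul_pow, hb2, sq_abs]
    have : α ^ 2 * ((1 - 1 / α) ^ 2 + 1) = (α - 1) ^ 2 + α ^ 2 := by field_simp
    rw [this]
    -- The claim is `7 α² - 8 α + 3 ≥ 0`, and seven times the left side is `(7 α - 4)² + 5`.
    nlinarith [sq_nonneg (7 * α - 4)]
  have h3 : 0 < √(1 + α ^ 2) := by positivity
  have h4 : 0 < |α| := abs_pos.2 hα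
  rw [← div_eq_mul_inv, inv_mul_eq_div, div_div, div_le_div_iff₀ (by positivity) h3]
  nlinarith [Real.pi_pos]

section Convergence

variable {n : ℕ} {ι : Type}

theorem couplingDensity_mul_lintegral_le (c : Fin n → ι) {α : ι → ℝ} (hα : ∀ i, α i ≠ 0) :
    couplingDensity c α * ∫⁻ v : Fin n → ℝ, ∏ k,
        ENNReal.ofReal (1 + ((1 - 1 / α (c k)) * v k) ^ 2 + v k ^ 2)⁻¹ ≤
      ENNReal.ofReal ((2 * Real.pi) ^ n * ∏ k, (√(1 + α (c k) ^ 2))⁻¹) := by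
  rw [volume_pi, lintegral_fintype_prod_eq_prod (fun _ : Fin n => (volume : Measure ℝ))
    (fun k v => ENNReal.ofReal (1 + ((1 - 1 / α (c k)) * v) ^ 2 + v ^ 2)⁻¹) (fun k => by fun_prop),
    couplingDensity, ← Finset.prod_mul_distrib]
  refine (Finset.prod_le_prod' fun k _ => rayDensity_mul_lintegral_le (hα (c k))).trans ?_
  rw [← ENNReal.ofReal_prod_of_nonneg fun _ _ => by positivity, Finset.prod_mul_distrib,
    Finset.prod_const, Finset.card_univ, Fintype.card_fin]

variable [Fintype ι]

/-- Each variable supplies half a power of `(1 + α²)⁻¹`; `hB` asks that on `S` this amounts to a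
full power for each parameter. -/
theorem integrable_sub_of_bound {c : Fin n → ι} {S : Set (ι → ℝ)} (hS : MeasurableSet S)
    {K : Measure (Phase n)} (hK : MeasurePreserving (rays c)
      (((volume.restrict S).withDensity (couplingDensity c)).prod volume) K)
    (f : SchwartzMap (Phase n) ℂ) (z : Phase n) {B : ℝ}
    (hB : ∀ α ∈ S, ∏ k, (√(1 + α (c k) ^ 2))⁻¹ ≤ B * ∏ i, (1 + α i ^ 2)⁻¹) :
    Integrable (fun w => f (z - w)) K := by
  obtain ⟨C, hC0, hC⟩ := exists_norm_sub_le_prod f z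
  have hcont : Continuous fun w => f (z - w) := by fun_prop
  refine ⟨hcont.aestronglyMeasurable, ?_⟩
  have hm : Measurable fun a => ‖f (z - rays c a)‖ₑ :=
    (hcont.enorm.measurable).comp (measurable_rays c)
  rw [hasFiniteIntegral_iff_enorm, ← hK.lintegral_comp hcont.enorm.measurable,
    lintegral_prod _ hm.aemeasurable,
    lintegral_withDensity_eq_lintegral_mul _ (measurable_couplingDensity c)
      hm.lintegral_prod_right']
  have hint : Integrable fun α : ι → ℝ =>
      C * ((2 * Real.pi) ^ n * (B * ∏ i, (1 + α i ^ 2)⁻¹)) :=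
    (((Integrable.fintype_prod fun _ => integrable_inv_one_add_sq).const_mul _).const_mul
      _).const_mul _
  refine lt_of_le_of_lt ?_ (hint.restrict (s := S)).lintegral_lt_top
  refine lintegral_mono_ae ?_
  filter_upwards [ae_restrict_mem hS, ae_restrict_of_ae ae_forall_ne_zero] with α hαS hα
  simp only [Pi.mul_apply]
  calc
    _ ≤ couplingDensity c α * ∫⁻ v : Fin n → ℝ, ENNReal.ofReal C * ∏ k,
        ENNReal.ofReal (1 + ((1 - 1 / α (c k)) * v k) ^ 2 + v k ^ 2)⁻¹ := by
      gcongr with v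
      rw [← ENNReal.ofReal_prod_of_nonneg fun _ _ => by positivity, ← ENNReal.ofReal_mul hC0,
        ← ofReal_norm]
      exact ENNReal.ofReal_le_ofReal (hC (rays c (α, v)))
    _ = ENNReal.ofReal C * (couplingDensity c α * ∫⁻ v : Fin n → ℝ, ∏ k,
        ENNReal.ofReal (1 + ((1 - 1 / α (c k)) * v k) ^ 2 + v k ^ 2)⁻¹) := by
      rw [lintegral_const_mul' _ _ (by simp), mul_left_comm]
    _ ≤ ENNReal.ofReal C *
        ENNReal.ofReal ((2 * Real.pi) ^ n * ∏ k, (√(1 + α (c k) ^ 2))⁻¹) := by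
      gcongr
      exact couplingDensity_mul_lintegral_le c hα
    _ ≤ _ := by
      rw [← ENNReal.ofReal_mul hC0]
      refine ENNReal.ofReal_le_ofReal ?_
      gcongr
      exact hB α hαS

theorem inv_sqrt_one_add_sq_le {a A : ℝ} (h : |a| ≤ A) :
    (√(1 + a ^ 2))⁻¹ ≤ √(1 + A ^ 2) * (1 + a ^ 2)⁻¹ := by
  have h1 : a ^ 2 ≤ A ^ 2 := by
    rw [← sq_abs]
    exact pow_le_pow_left₀ (abs_nonneg a) h 2
  have h2 : 0 < √(1 + a ^ 2) := by positivity
  rw [← div_eq_mul_inv, inv_eq_one_div, div_le_div_iff₀ h2 (by positivity), one_mul]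
  calc 1 + a ^ 2 = √(1 + a ^ 2) * √(1 + a ^ 2) := (Real.mul_self_sqrt (by positivity)).symm
    _ ≤ √(1 + A ^ 2) * √(1 + a ^ 2) := by gcongr

/-- The assertions about the normal operator of `transform c`, with kernel `K`, that hold for every
coupling, the truncated ones for parameters bounded at the indices `κ j`. -/
theorem normal_operator {J : Type} [Countable J] {c : Fin n → ι} {K : Measure (Phase n)}
    (hK : MeasurePreserving (rays c) (rayMeasure c) K) (κ : J → Fin n)
    (hB : ∀ A : ℝ, ∃ B : ℝ, ∀ α ∈ paramBox c κ A,
      ∏ k, (√(1 + α (c k) ^ 2))⁻¹ ≤ B * ∏ i, (1 + α i ^ 2)⁻¹)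
    (f : SchwartzMap (Phase n) ℂ) (z : Phase n) :
    edual c (etransform c fun w => ‖f w‖ₑ) z = econv K (fun w => ‖f w‖ₑ) z ∧
    (Integrable (fun w => f (z - w)) K →
      Integrable (fun α => transform c f α (focal c α z)) ∧
      dual c (transform c f) z = conv K f z) ∧
    ∀ A : ℝ, Integrable (fun w => f (z - w)) (K.restrict (coneBox κ A)) ∧
      IntegrableOn (fun α => transform c f α (focal c α z)) (paramBox c κ A) ∧
      ∫ α in paramBox c κ A, transform c f α (focal c α z) =
        conv (K.restrict (coneBox κ A)) f z := by
  refine ⟨edual_etransform hK f.continuous.enorm.measurable z, fun hf => ?_, fun A => ?_⟩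
  · have h := measurePreserving_rays_restrict hK MeasurableSet.univ MeasurableSet.univ
      (ae_of_all _ fun a => by simp)
    rw [Measure.restrict_univ (μ := K)] at h
    have h' := integrable_transform_and_integral_eq h hf
    rwa [integrableOn_univ, setIntegral_univ] at h'
  · have h := measurePreserving_rays_restrict hK (measurableSet_paramBox c κ A)
      (measurableSet_coneBox κ A) (ae_rays_mem_coneBox c κ A)
    obtain ⟨B, hB⟩ := hB A
    have hf := integrable_sub_of_bound (measurableSet_paramBox c κ A) h f z hB
    exact ⟨hf, integrable_transform_and_integral_eq h hf⟩

end Convergence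

/-! ### Decay in the parameters for the two couplings, and identification of the kernels. -/

theorem bar_bound (n : ℕ) (A : ℝ) : ∃ B : ℝ, ∀ α ∈ paramBox (barCoupling n) id A,
    ∏ k, (√(1 + α (barCoupling n k) ^ 2))⁻¹ ≤ B * ∏ i, (1 + α i ^ 2)⁻¹ := by
  refine ⟨∏ _i : Fin n, √(1 + A ^ 2), fun α hα => ?_⟩
  rw [← Finset.prod_mul_distrib]
  exact Finset.prod_le_prod (fun _ _ => by positivity) fun k _ => inv_sqrt_one_add_sq_le (hα k)

/-- The two variables of a pair together give exactly `(1 + α²)⁻¹`; only a last, unpaired parameter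
has to be bounded. -/
theorem tilde_bound (n : ℕ) (A : ℝ) : ∃ B : ℝ,
    ∀ α ∈ paramBox (tildeCoupling n) (fun j => indexEquiv n (.inr j)) A,
      ∏ k, (√(1 + α (tildeCoupling n k) ^ 2))⁻¹ ≤ B * ∏ i, (1 + α i ^ 2)⁻¹ := by
  refine ⟨∏ _j : Fin (n % 2), √(1 + A ^ 2), fun α hα => ?_⟩
  rw [prod_indexEquiv, ← (paramEquiv n).prod_comp, Fintype.prod_sum_type, mul_left_comm,
    ← Finset.prod_mul_distrib]
  simp only [tildeCoupling_indexEquiv_fst, tildeCoupling_indexEquiv_snd,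
    tildeCoupling_indexEquiv_last]
  refine mul_le_mul (le_of_eq ?_) ?_ (Finset.prod_nonneg fun _ _ => by positivity)
    (Finset.prod_nonneg fun _ _ => by positivity)
  · refine Finset.prod_congr rfl fun i _ => ?_
    rw [← mul_inv, Real.mul_self_sqrt (by positivity)]
  · refine Finset.prod_le_prod (fun _ _ => by positivity) fun j _ => inv_sqrt_one_add_sq_le ?_
    have := hα j
    rwa [tildeCoupling_indexEquiv_last] at this

theorem tilde_bound_of_odd {n : ℕ} (hn : Odd n) (A : ℝ) : ∃ B : ℝ,
    ∀ α ∈ paramBox (tildeCoupling n) (fun _ : Unit => lastIdx hn) A,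
      ∏ k, (√(1 + α (tildeCoupling n k) ^ 2))⁻¹ ≤ B * ∏ i, (1 + α i ^ 2)⁻¹ := by
  obtain ⟨B, hB⟩ := tilde_bound n A
  exact ⟨B, fun α hα => hB α fun _ => hα ()⟩

theorem delta_sinDiff (n : ℕ) : delta (sinDiff n) = tildeDelta n := by
  have H : ∃ ν : Measure (Phase n), IsDelta (sinDiff n) ν := ⟨_, isDelta_tildeDelta n⟩
  rw [delta, dif_pos H]
  exact H.choose_spec.unique (isDelta_tildeDelta n)

theorem evenKernel_eq_tildeKernel {n : ℕ} (hn : Even n) : evenKernel n = tildeKernel n := by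
  have : IsEmpty (Fin (n % 2)) := by rw [Nat.even_iff.1 hn]; infer_instance
  rw [← tildeDelta_withDensity, evenKernel, delta_sinDiff]
  simp

theorem oddKernel_eq_tildeKernel {n : ℕ} (hn : Odd n) : oddKernel hn = tildeKernel n := by
  have : Unique (Fin (n % 2)) := by rw [Nat.odd_iff.1 hn]; infer_instance
  rw [← tildeDelta_withDensity, oddKernel, delta_sinDiff]
  simp only [Fintype.prod_unique]
  rfl

end Photography

end

open Photography in
theorem mainTheorem9 (n : ℕ) (f : SchwartzMap (Phase n) ℂ) :
    -- the integrals defining the two transforms of `f` converge absolutely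
    (∀ (α : Fin n → ℝ) (xbar : Fin n → ℝ), (∀ i, α i ≠ 0) →
      Integrable fun u => f (ray (barCoupling n) α xbar u)) ∧
    (∀ (α : Fin ((n + 1) / 2) → ℝ) (xbar : Fin n → ℝ), (∀ i, α i ≠ 0) →
      Integrable fun u => f (ray (tildeCoupling n) α xbar u)) ∧
    -- the product of delta functions is well defined
    IsDelta (sinDiff n) (delta (sinDiff n)) ∧
    -- (i) the normal operator of the fully decoupled transform
    (∀ z : Phase n,
      edual (barCoupling n) (etransform (barCoupling n) fun w => ‖f w‖ₑ) z =
        econv (barKernel n) (fun w => ‖f w‖ₑ) z ∧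
      (Integrable (fun w => f (z - w)) (barKernel n) →
        Integrable (fun α => transform (barCoupling n) f α (focal (barCoupling n) α z)) ∧
        dual (barCoupling n) (transform (barCoupling n) f) z = conv (barKernel n) f z) ∧
      ∀ A : ℝ,
        Integrable (fun w => f (z - w))
          ((barKernel n).restrict {w | ∀ k, |w.2 k| ≤ A * |w.1 k - w.2 k|}) ∧
        IntegrableOn (fun α => transform (barCoupling n) f α (focal (barCoupling n) α z))
          {α | ∀ k, |α k| ≤ A} ∧
        ∫ α in {α | ∀ k, |α k| ≤ A}, transform (barCoupling n) f α (focal (barCoupling n) α z) =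
          conv ((barKernel n).restrict {w | ∀ k, |w.2 k| ≤ A * |w.1 k - w.2 k|}) f z) ∧
    -- (ii) the normal operator of the pairwise coupled transform, even dimension
    (Even n → ∀ z : Phase n,
      edual (tildeCoupling n) (etransform (tildeCoupling n) fun w => ‖f w‖ₑ) z =
        econv (evenKernel n) (fun w => ‖f w‖ₑ) z ∧
      Integrable (fun w => f (z - w)) (evenKernel n) ∧
      Integrable (fun α => transform (tildeCoupling n) f α (focal (tildeCoupling n) α z)) ∧
      dual (tildeCoupling n) (transform (tildeCoupling n) f) z = conv (evenKernel n) f z) ∧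
    -- (ii) the normal operator of the pairwise coupled transform, odd dimension
    (∀ hn : Odd n, ∀ z : Phase n,
      edual (tildeCoupling n) (etransform (tildeCoupling n) fun w => ‖f w‖ₑ) z =
        econv (oddKernel hn) (fun w => ‖f w‖ₑ) z ∧
      (Integrable (fun w => f (z - w)) (oddKernel hn) →
        Integrable (fun α => transform (tildeCoupling n) f α (focal (tildeCoupling n) α z)) ∧
        dual (tildeCoupling n) (transform (tildeCoupling n) f) z = conv (oddKernel hn) f z) ∧
      ∀ A : ℝ,
        Integrable (fun w => f (z - w)) ((oddKernel hn).restrict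
          {w | |w.2 (lastIdx hn)| ≤ A * |w.1 (lastIdx hn) - w.2 (lastIdx hn)|}) ∧
        IntegrableOn (fun α => transform (tildeCoupling n) f α (focal (tildeCoupling n) α z))
          {α | |α (tildeCoupling n (lastIdx hn))| ≤ A} ∧
        ∫ α in {α | |α (tildeCoupling n (lastIdx hn))| ≤ A},
            transform (tildeCoupling n) f α (focal (tildeCoupling n) α z) =
          conv ((oddKernel hn).restrict
            {w | |w.2 (lastIdx hn)| ≤ A * |w.1 (lastIdx hn) - w.2 (lastIdx hn)|}) f z) := by
  refine ⟨fun α xbar _ => integrable_comp_ray f _ α xbar,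
    fun α xbar _ => integrable_comp_ray f _ α xbar,
    by rw [delta_sinDiff]; exact isDelta_tildeDelta n,
    normal_operator (measurePreserving_rays_bar n) id (bar_bound n) f, fun hn z => ?_,
    fun hn z => ?_⟩
  · have : IsEmpty (Fin (n % 2)) := by rw [Nat.even_iff.1 hn]; infer_instance
    obtain ⟨h1, h2, h3⟩ := normal_operator (measurePreserving_rays_tilde n)
      (fun j => indexEquiv n (.inr j)) (tilde_bound n) f z
    -- For even `n` no index is truncated, so the box is the whole space and the value `0` of `A` is
    -- arbitrary.
    have h4 := (h3 0).1
    rw [show coneBox (fun j => indexEquiv n (.inr j)) 0 = Set.univ from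
      Set.eq_univ_of_forall fun w j => isEmptyElim j, Measure.restrict_univ] at h4
    rw [evenKernel_eq_tildeKernel hn]
    exact ⟨h1, h4, h2 h4⟩
  · have h := normal_operator (measurePreserving_rays_tilde n)
      (fun _ : Unit => lastIdx hn) (tilde_bound_of_odd hn) f z
    rw [← oddKernel_eq_tildeKernel hn] at h
    simpa only [paramBox, coneBox, forall_const] using h
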